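/- A strict partition is a finite strictly decreasing sequence $\lambda=(\lambda_1>\dots>\lambda_\ell)$ of positive integers, with $\ell(\lambda)=\ell$, $|\lambda|=\sum_i\lambda_i$, and $\lambda_i=0$ for $i>\ell$. Its shifted diagram has in row $i$ the boxes $(i,i+1),\dots,(i,i+\lambda_i)$. The content of $\square=(i,j)$ is $c_\square=j-i$. Its hook length is the number of boxes to its right in the same row, plus the number of boxes below it in the same column, plus $1$, plus $\lambda_j$; $H_\lambda$ is the product of all hook lengths. Write $\lambda\supseteq\mu$ if $\lambda_i\ge\mu_i$ for all $i\geq 1$, and then $|\lambda/\mu|=|\lambda|-|\mu|$; $f_{\lambda/\mu}$ is the number of standard shifted Young tableaux of shape $\lambda/\mu$ (bijective fillings of the boxes of $\lambda$ not in $\mu$ by $1,\dots,|\lambda/\mu|$, increasing along rows and down columns). Let $(\alpha_1,\beta_1),\dots,(\alpha_m,\beta_m)$, $\alpha_1>\dots>\alpha_m$, be the boxes of $\lambda$ whose removal leaves the diagram of a strict partition, and put $\alpha_{m+1}=0$, $\beta_0=\ell(\lambda)+1$, $y_j=\beta_j-\alpha_j$ ($1\le j\le m$), $x_i=\beta_i-\alpha_{i+1}$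 ($0\le i\le m$). For $k\ge 0$ let $$q_k(\lambda)=\sum_{i=0}^m\binom{x_i}{2}^k-\sum_{j=1}^m\binom{y_j}{2}^k ,$$ and for a partition $\nu=(\nu_1,\dots,\nu_s)$ let $q_\nu(\lambda)=q_{\nu_1}(\lambda)\cdots q_{\nu_s}(\lambda)$. Let $K$ be a field of characteristic $0$. For a $K$-valued function $g$ of strict partitions define $$Dg(\lambda)=\sum_{\ell(\lambda^+)>\ell(\lambda)}g(\lambda^+)+2\sum_{\ell(\lambda^+)=\ell(\lambda)}g(\lambda^+)-g(\lambda),$$ where $\lambda^+$ runs over the strict partitions $\lambda^+\supseteq\lambda$ with $|\lambda^+|=|\lambda|+1$. Theorem. Let $\nu$ be a partition, $\mu$ a strict partition, and $Q$ a symmetric function over $K$ (a formal power series of bounded degree in countably many variables, invariant under permutations of the variables). Write $Q\bigl(\binom{c_\square}{2}:\square\in\lambda\bigr)$ for the value of $Q$ when $|\lambda|$ of the variables are replaced by $\binom{c_\square}{2}$, $\square\in\lambda$, and all other variables by $0$. Then there exists $r\in\mathbb N$ such that $$D^r\Bigl(\frac{Q\bigl(\binom{c_\square}{2}:\square\in\lambda\bigr)\,q_\nu(\lambda)}{H_\lambda}\Bigr)=0\quad\text{for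 every strict partition }\lambda .$$ Consequently, $$P(n)=\sum_{\lambda\supseteq\mu,\ |\lambda/\mu|=n}\frac{2^{|\lambda|-|\mu|-\ell(\lambda)+\ell(\mu)}f_{\lambda/\mu}}{H_\lambda}\,Q\Bigl(\binom{c_\square}{2}:\square\in\lambda\Bigr)q_\nu(\lambda)$$ is a polynomial in $n$, that is, there is a polynomial over $K$ whose value at each integer $n\ge 0$ is $P(n)$. -/

import Mathlib

/-- A strict partition: a finite strictly decreasing sequence of positive integers. -/
@[ext]
structure StrictPartition where
  parts : List ℕ
  decreasing : parts.Pairwise (· > ·)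
  pos : ∀ p ∈ parts, 0 < p

namespace StrictPartition

/-- `l.part i` is the `i`-th part of `l` for `i ≥ 1` (so `part` is indexed from `1`);
it is `0` for `i` larger than the length. -/
def part (l : StrictPartition) (i : ℕ) : ℕ := l.parts.getD (i - 1) 0

/-- The size `|l|`. -/
def size (l : StrictPartition) : ℕ := l.parts.sum

/-- The number `ℓ(l)` of parts. -/
def length (l : StrictPartition) : ℕ := l.parts.length

/-- The shifted Young diagram: row `i` (for `1 ≤ i ≤ ℓ(l)`) consists of the boxes
`(i, i + 1), …, (i, i + l_i)`. -/
def diagram (l : StrictPartition) : Finset (ℕ × ℕ) :=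
  (Finset.Icc 1 l.length).biUnion fun i =>
    (Finset.Icc (i + 1) (i + l.part i)).image fun j => (i, j)

/-- The content `j - i` of the box `(i, j)`; all boxes of a shifted diagram have `j > i`. -/
def content (b : ℕ × ℕ) : ℕ := b.2 - b.1

/-- The hook length of the box `(i, j)` in `l`: the number of boxes to its right in the same row,
plus the number of boxes below it in the same column, plus one, plus the part `l_j`. -/
def hookLength (l : StrictPartition) (b : ℕ × ℕ) : ℕ :=
  (l.diagram.filter fun c => c.1 = b.1 ∧ b.2 < c.2).card
    + (l.diagram.filter fun c => c.2 = b.2 ∧ b.1 < c.1).card + 1 + l.part b.2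

/-- `H_l`, the product of all hook lengths. -/
def hookProduct (l : StrictPartition) : ℕ := ∏ b ∈ l.diagram, l.hookLength b

/-- `m.Contained l` means `l ⊇ m`, that is, `m_i ≤ l_i` for all `i ≥ 1`. -/
def Contained (m l : StrictPartition) : Prop := ∀ i, 1 ≤ i → m.part i ≤ l.part i

theorem finite_size_eq (n : ℕ) : {l : StrictPartition | l.size = n}.Finite := by
  let F : {l : StrictPartition | l.size = n} → Composition n := fun l =>
    ⟨l.1.parts, fun {i} hi => l.1.pos i hi, l.2⟩
  have hF : Function.Injective F := by
    intro a b h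
    exact Subtype.ext (StrictPartition.ext (congrArg Composition.blocks h))
  exact Set.finite_coe_iff.mp (Finite.of_injective F hF)

/-- The finite set of strict partitions of size `n`. -/
noncomputable def ofSize (n : ℕ) : Finset StrictPartition := (finite_size_eq n).toFinset

open Classical in
/-- The strict partitions `l ⊇ m` with `|l| = |m| + n`, that is, `|l/m| = n`. -/
noncomputable def above (m : StrictPartition) (n : ℕ) : Finset StrictPartition :=
  (ofSize (m.size + n)).filter fun l => m.Contained l

/-- The boxes of the skew shifted diagram `l/m`. -/
def skewDiagram (l m : StrictPartition) : Finset (ℕ × ℕ) := l.diagram \ m.diagram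

/-- A bijective filling of a finite set of boxes by `0, 1, …, N - 1` is standard if it is
increasing along each row and down each column. -/
def IsStandard {s : Finset (ℕ × ℕ)} (T : {b // b ∈ s} ≃ Fin s.card) : Prop :=
  (∀ a b : {b // b ∈ s}, a.1.1 = b.1.1 → a.1.2 < b.1.2 → T a < T b) ∧
  (∀ a b : {b // b ∈ s}, a.1.2 = b.1.2 → a.1.1 < b.1.1 → T a < T b)

/-- `f_{l/m}`, the number of standard shifted Young tableaux of shape `l/m`. -/
noncomputable def numTableaux (l m : StrictPartition) : ℕ :=
  Nat.card {T : {b // b ∈ skewDiagram l m} ≃ Fin (skewDiagram l m).card // IsStandard T}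

/-- The difference operator on functions of strict partitions. The sums are over the strict
partitions obtained from `l` by adding one box. -/
noncomputable def diffOp {K : Type*} [Field K] (g : StrictPartition → K) :
    StrictPartition → K := fun l =>
  ∑ k ∈ (above l 1).filter (fun k => l.length < k.length), g k
    + 2 * ∑ k ∈ (above l 1).filter (fun k => k.length = l.length), g k - g l

open Classical in
/-- The outer corners of `l`: the boxes whose removal leaves a (diagram of a) strict partition. -/
noncomputable def outerCorners (l : StrictPartition) : Finset (ℕ × ℕ) :=
  l.diagram.filter fun b => ∃ k : StrictPartition, k.diagram = l.diagram.erase b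

/-- The rows `α_1 > α_2 > ⋯ > α_m` of the outer corners. -/
noncomputable def outerRows (l : StrictPartition) : List ℕ :=
  (l.outerCorners.image Prod.fst).sort (· ≥ ·)

/-- The number `m` of outer corners. -/
noncomputable def numCorners (l : StrictPartition) : ℕ := l.outerCorners.card

/-- The row `α_j` of the `j`-th outer corner, for `1 ≤ j ≤ m`; moreover `α_{m+1} = 0`. -/
noncomputable def cornerRow (l : StrictPartition) (j : ℕ) : ℕ := l.outerRows.getD (j - 1) 0

/-- `β_0 = ℓ(l) + 1`, and `β_j` for `1 ≤ j ≤ m` is the column of the `j`-th outer corner, which is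
the last box of row `α_j`. -/
noncomputable def cornerCol (l : StrictPartition) (j : ℕ) : ℕ :=
  if j = 0 then l.length + 1 else l.cornerRow j + l.part (l.cornerRow j)

/-- The content `x_i = β_i - α_{i+1}` of the `i`-th inner corner, `0 ≤ i ≤ m`. -/
noncomputable def innerContent (l : StrictPartition) (i : ℕ) : ℕ :=
  content (l.cornerRow (i + 1), l.cornerCol i)

/-- The content `y_j = β_j - α_j` of the `j`-th outer corner, `1 ≤ j ≤ m`. -/
noncomputable def outerContent (l : StrictPartition) (j : ℕ) : ℕ :=
  content (l.cornerRow j, l.cornerCol j)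

/-- `q_k(l) = ∑_{i=0}^m binom(x_i, 2)^k - ∑_{j=1}^m binom(y_j, 2)^k`. -/
noncomputable def q (K : Type*) [Field K] (k : ℕ) (l : StrictPartition) : K :=
  ∑ i ∈ Finset.range (l.numCorners + 1), ((l.innerContent i).choose 2 : K) ^ k
    - ∑ j ∈ Finset.Icc 1 l.numCorners, ((l.outerContent j).choose 2 : K) ^ k

/-- `q_ν(l)`, the product of `q_k(l)` over the parts `k` of the partition `ν`. -/
noncomputable def qPartition (K : Type*) [Field K] {N : ℕ} (ν : Nat.Partition N)
    (l : StrictPartition) : K :=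
  (ν.parts.map fun k => q K k l).prod

/-- The multiset of the values `binom(c_b, 2)`, over the boxes `b` of `l`. -/
def contentValues (K : Type*) [Field K] (l : StrictPartition) : Multiset K :=
  l.diagram.val.map fun b => ((content b).choose 2 : K)

end StrictPartition

/-- A symmetric function over `K`: a formal power series in the variables `x_0, x_1, x_2, …`, of
bounded degree and invariant under all permutations of the variables. -/
structure SymmetricFunction (K : Type*) [Field K] where
  series : MvPowerSeries ℕ K
  symmetric : ∀ (σ : Equiv.Perm ℕ) (d : ℕ →₀ ℕ),
    MvPowerSeries.coeff (d.mapDomain σ) series = MvPowerSeries.coeff d series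
  bounded : ∃ N : ℕ, ∀ d : ℕ →₀ ℕ, N < d.degree → MvPowerSeries.coeff d series = 0

/-- The value of `Q` when as many variables as `s` has elements are replaced by the elements of
`s`, and all other variables by `0`. By symmetry the order chosen for the elements of `s`
does not matter. Only finitely many terms of the sum are nonzero: the degree of `Q` is bounded, and
a monomial with a variable of index at least `s.card` has value `0`. -/
noncomputable def SymmetricFunction.eval {K : Type*} [Field K] (Q : SymmetricFunction K)
    (s : Multiset K) : K :=
  ∑ᶠ d : ℕ →₀ ℕ, MvPowerSeries.coeff d Q.series * d.prod fun i e => s.toList.getD i 0 ^ e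

namespace StrictPartition

/-- The set of parts of a strict partition. -/
def partSet (l : StrictPartition) : Finset ℕ := l.parts.toFinset

theorem mem_partSet {l : StrictPartition} {p : ℕ} : p ∈ l.partSet ↔ p ∈ l.parts := by
  simp [partSet]

theorem zero_notMem_partSet (l : StrictPartition) : 0 ∉ l.partSet := fun h =>
  (l.pos 0 (mem_partSet.1 h)).ne rfl

theorem nodup_parts (l : StrictPartition) : l.parts.Nodup :=
  l.decreasing.imp fun h => ne_of_gt h

theorem partSet_injective : Function.Injective partSet := by
  intro l k h
  apply StrictPartition.ext
  have hp : l.parts.Perm k.parts :=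
    (List.perm_ext_iff_of_nodup l.nodup_parts k.nodup_parts).2 fun p => by
      rw [← mem_partSet, ← mem_partSet, h]
  exact hp.eq_of_pairwise' (l.decreasing.imp fun h => le_of_lt h)
    (k.decreasing.imp fun h => le_of_lt h)

theorem sum_parts_map {M : Type*} [AddCommMonoid M] (l : StrictPartition) (f : ℕ → M) :
    (l.parts.map f).sum = ∑ p ∈ l.partSet, f p :=
  (List.sum_toFinset f l.nodup_parts).symm

theorem size_eq_sum (l : StrictPartition) : l.size = ∑ p ∈ l.partSet, p := by
  simpa [size] using l.sum_parts_map id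

theorem length_eq_card (l : StrictPartition) : l.length = l.partSet.card :=
  (List.toFinset_card_of_nodup l.nodup_parts).symm

/-- The strict partition with a given finite set of positive parts. -/
noncomputable def ofPartSet (s : Finset ℕ) (hs : 0 ∉ s) : StrictPartition where
  parts := s.sort (· ≥ ·)
  decreasing := s.sortedGT_sort.pairwise
  pos _ hp := Nat.pos_of_ne_zero fun h => hs (h ▸ (Finset.mem_sort _).1 hp)

@[simp]
theorem partSet_ofPartSet (s : Finset ℕ) (hs : 0 ∉ s) : (ofPartSet s hs).partSet = s := by
  ext
  simp [mem_partSet, ofPartSet]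

/-- The number of parts that are at least `t`, which is also the number of boxes of
content `t`. -/
def countGE (l : StrictPartition) (t : ℕ) : ℕ := (l.partSet.filter fun p => t ≤ p).card

theorem countGE_antitone (l : StrictPartition) : Antitone l.countGE := fun _ _ h =>
  Finset.card_le_card (Finset.monotone_filter_right _ fun _ _ hp => h.trans hp)

theorem countGE_eq_succ (l : StrictPartition) (t : ℕ) :
    l.countGE t = l.countGE (t + 1) + if t ∈ l.partSet then 1 else 0 := by
  have h : (l.partSet.filter fun p => t ≤ p)
      = (l.partSet.filter fun p => t + 1 ≤ p) ∪ l.partSet.filter fun p => p = t := by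
    rw [← Finset.filter_or]
    apply Finset.filter_congr
    intro p _
    omega
  have hd : Disjoint (l.partSet.filter fun p => t + 1 ≤ p)
      (l.partSet.filter fun p => p = t) := by
    apply Finset.disjoint_filter.2
    intro p _
    omega
  rw [countGE, h, Finset.card_union_of_disjoint hd, countGE, Finset.filter_eq']
  split_ifs <;> simp

theorem countGE_one (l : StrictPartition) : l.countGE 1 = l.length := by
  rw [countGE, length_eq_card, Finset.filter_true_of_mem]
  exact fun p hp => l.pos p (mem_partSet.1 hp)

theorem le_getD_iff_lt_countP {L : List ℕ} (hL : L.Pairwise (· > ·)) {t : ℕ} (ht : 1 ≤ t)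
    (n : ℕ) : t ≤ L.getD n 0 ↔ n < L.countP (fun p => t ≤ p) := by
  induction L generalizing n with
  | nil => simp; omega
  | cons a L ih =>
    rw [List.pairwise_cons] at hL
    by_cases ha : t ≤ a
    · rw [List.countP_cons_of_pos (by simpa using ha)]
      cases n with
      | zero => simpa using ha
      | succ n => rw [List.getD_cons_succ, ih hL.2]; omega
    · have h0 : L.countP (fun p => t ≤ p) = 0 := by
        rw [List.countP_eq_zero]
        intro b hb
        have := hL.1 b hb
        simp only [decide_eq_true_eq]
        omega
      rw [List.countP_cons_of_neg (by simpa using ha)]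
      cases n with
      | zero => simp [h0]; omega
      | succ n => rw [List.getD_cons_succ, ih hL.2]; omega

theorem countGE_eq_countP (l : StrictPartition) (t : ℕ) :
    l.countGE t = l.parts.countP (fun p => t ≤ p) := by
  rw [List.countP_eq_length_filter, ← List.toFinset_card_of_nodup (l.nodup_parts.filter _),
    List.toFinset_filter, countGE, partSet]
  simp only [decide_eq_true_eq]

theorem le_part_iff (l : StrictPartition) {i t : ℕ} (hi : 1 ≤ i) (ht : 1 ≤ t) :
    t ≤ l.part i ↔ i ≤ l.countGE t := by
  rw [part, le_getD_iff_lt_countP l.decreasing ht, countGE_eq_countP]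
  omega

theorem part_pos_iff (l : StrictPartition) {i : ℕ} (hi : 1 ≤ i) :
    0 < l.part i ↔ i ≤ l.length := by
  rw [← countGE_one, ← l.le_part_iff hi le_rfl, Nat.succ_le_iff]

theorem mem_diagram {l : StrictPartition} {b : ℕ × ℕ} :
    b ∈ l.diagram ↔ 1 ≤ b.1 ∧ b.1 < b.2 ∧ b.1 ≤ l.countGE (b.2 - b.1) := by
  obtain ⟨i, j⟩ := b
  simp only [diagram, Finset.mem_biUnion, Finset.mem_Icc, Finset.mem_image, Prod.mk.injEq]
  constructor
  · rintro ⟨i', ⟨h1, _⟩, j', ⟨h3, h4⟩, rfl, rfl⟩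
    exact ⟨h1, h3, (l.le_part_iff h1 (by omega)).1 (by omega)⟩
  · rintro ⟨h1, h2, h3⟩
    have h4 := (l.le_part_iff h1 (by omega)).2 h3
    exact ⟨i, ⟨h1, (l.part_pos_iff h1).1 (by omega)⟩, j, ⟨h2, by omega⟩, rfl, rfl⟩

theorem mem_diagram_iff_le_part {l : StrictPartition} {i j : ℕ} :
    (i, j) ∈ l.diagram ↔ 1 ≤ i ∧ i < j ∧ j ≤ i + l.part i := by
  rw [mem_diagram]
  constructor
  · rintro ⟨h1, h2, h3⟩
    have := (l.le_part_iff h1 (by simp only; omega)).2 h3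
    exact ⟨h1, h2, by simp only at *; omega⟩
  · rintro ⟨h1, h2, h3⟩
    exact ⟨h1, h2, (l.le_part_iff h1 (by simp only; omega)).1 (by simp only; omega)⟩

theorem contained_iff_countGE {m l : StrictPartition} :
    m.Contained l ↔ ∀ t, 1 ≤ t → m.countGE t ≤ l.countGE t := by
  constructor
  · intro h t ht
    rcases Nat.eq_zero_or_pos (m.countGE t) with h0 | h0
    · omega
    · exact (l.le_part_iff h0 ht).1 (((m.le_part_iff h0 ht).2 le_rfl).trans (h _ h0))
  · intro h i hi
    rcases Nat.eq_zero_or_pos (m.part i) with h0 | h0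
    · omega
    · exact (l.le_part_iff hi h0).2 (((m.le_part_iff hi h0).1 le_rfl).trans (h _ h0))

theorem contained_iff_diagram_subset {m l : StrictPartition} :
    m.Contained l ↔ m.diagram ⊆ l.diagram := by
  constructor
  · intro h b hb
    rw [mem_diagram] at hb ⊢
    exact ⟨hb.1, hb.2.1, hb.2.2.trans (contained_iff_countGE.1 h _ (by omega))⟩
  · intro h
    rw [contained_iff_countGE]
    intro t ht
    rcases Nat.eq_zero_or_pos (m.countGE t) with h0 | h0
    · omega
    · have := @h (m.countGE t, m.countGE t + t)
      simp only [mem_diagram, Nat.add_sub_cancel_left] at this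
      exact (this ⟨h0, by omega, le_rfl⟩).2.2

theorem Contained.refl (l : StrictPartition) : l.Contained l := fun _ _ => le_rfl

theorem Contained.trans {a b c : StrictPartition} (h : a.Contained b) (h' : b.Contained c) :
    a.Contained c := fun i hi => (h i hi).trans (h' i hi)

theorem sum_partSet_sum_Icc {M : Type*} [AddCommMonoid M] (l : StrictPartition) (f : ℕ → M)
    {n : ℕ} (hn : ∀ p ∈ l.partSet, p ≤ n) :
    ∑ p ∈ l.partSet, ∑ t ∈ Finset.Icc 1 p, f t
      = ∑ t ∈ Finset.Icc 1 n, l.countGE t • f t := by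
  simp_rw [countGE, ← Finset.sum_const]
  apply Finset.sum_comm'
  intro p t
  simp only [Finset.mem_Icc, Finset.mem_filter]
  constructor
  · rintro ⟨h1, h2, h3⟩
    exact ⟨⟨h1, h3⟩, h2, h3.trans (hn p h1)⟩
  · rintro ⟨⟨h1, h3⟩, h2, _⟩
    exact ⟨h1, h2, h3⟩

theorem size_eq_sum_countGE (l : StrictPartition) {n : ℕ} (hn : ∀ p ∈ l.partSet, p ≤ n) :
    l.size = ∑ t ∈ Finset.Icc 1 n, l.countGE t := by
  have := l.sum_partSet_sum_Icc (fun _ => 1) hn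
  simpa [size_eq_sum] using this

theorem eq_of_countGE_eq {l k : StrictPartition}
    (h : ∀ t, 1 ≤ t → l.countGE t = k.countGE t) : l = k := by
  apply partSet_injective
  ext t
  rcases Nat.eq_zero_or_pos t with rfl | ht
  · simp [zero_notMem_partSet]
  · have h1 := l.countGE_eq_succ t
    have h2 := k.countGE_eq_succ t
    rw [h t ht, h (t + 1) (by omega)] at h1
    split_ifs at h1 h2 <;> first | tauto | omega

/-- Replace the part `p` by `p + 1`; if `p = 0`, add a new part `1`. -/
noncomputable def addBox (l : StrictPartition) (p : ℕ) : StrictPartition :=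
  ofPartSet (insert (p + 1) (l.partSet.erase p)) (by simp [zero_notMem_partSet])

/-- The parts `p` (with `0` as an additional part) that may be increased by one. -/
def growable (l : StrictPartition) : Finset ℕ :=
  (insert 0 l.partSet).filter fun p => p + 1 ∉ l.partSet

theorem mem_growable {l : StrictPartition} {p : ℕ} :
    p ∈ l.growable ↔ (p = 0 ∨ p ∈ l.partSet) ∧ p + 1 ∉ l.partSet := by
  simp [growable]

@[simp]
theorem partSet_addBox (l : StrictPartition) (p : ℕ) :
    (l.addBox p).partSet = insert (p + 1) (l.partSet.erase p) :=
  partSet_ofPartSet _ _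

theorem sum_partSet_addBox {M : Type*} [AddCommGroup M] {l : StrictPartition} {p : ℕ}
    (hp : p ∈ l.growable) (f : ℕ → M) (hf : f 0 = 0) :
    ∑ r ∈ (l.addBox p).partSet, f r = ∑ r ∈ l.partSet, f r + (f (p + 1) - f p) := by
  rw [mem_growable] at hp
  rw [partSet_addBox, Finset.sum_insert (fun h => hp.2 (Finset.mem_of_mem_erase h))]
  rcases hp.1 with rfl | h
  · rw [Finset.erase_eq_of_notMem l.zero_notMem_partSet, hf]
    abel
  · rw [← Finset.sum_erase_add _ _ h]
    abel

theorem countGE_addBox {l : StrictPartition} {p t : ℕ} (hp : p ∈ l.growable) (ht : 1 ≤ t) :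
    (l.addBox p).countGE t = l.countGE t + if t = p + 1 then 1 else 0 := by
  have h := sum_partSet_addBox hp (fun r => if t ≤ r then (1 : ℤ) else 0)
    (if_neg (by omega))
  rw [Finset.sum_boole, Finset.sum_boole] at h
  simp only [countGE]
  split_ifs at h ⊢ <;> omega

theorem size_addBox {l : StrictPartition} {p : ℕ} (hp : p ∈ l.growable) :
    (l.addBox p).size = l.size + 1 := by
  have h := sum_partSet_addBox hp (fun r => (r : ℤ)) rfl
  rw [size_eq_sum, size_eq_sum]
  push_cast at h
  zify
  linarith

theorem length_addBox {l : StrictPartition} {p : ℕ} (hp : p ∈ l.growable) :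
    (l.addBox p).length = l.length + if p = 0 then 1 else 0 := by
  rw [← countGE_one, countGE_addBox hp le_rfl, countGE_one]
  simp

theorem contained_addBox {l : StrictPartition} {p : ℕ} (hp : p ∈ l.growable) :
    l.Contained (l.addBox p) := by
  rw [contained_iff_countGE]
  intro t ht
  rw [countGE_addBox hp ht]
  omega

theorem mem_above {m l : StrictPartition} {n : ℕ} :
    l ∈ m.above n ↔ l.size = m.size + n ∧ m.Contained l := by
  simp [above, ofSize]

theorem mem_above_one {l k : StrictPartition} :
    k ∈ l.above 1 ↔ ∃ p ∈ l.growable, l.addBox p = k := by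
  rw [mem_above]
  constructor
  · rintro ⟨hs, hc⟩
    rw [contained_iff_countGE] at hc
    obtain ⟨n, hn⟩ : ∃ n, ∀ p ∈ l.partSet ∪ k.partSet, p ≤ n :=
      ⟨_, fun p hp => Finset.le_sup (f := id) hp⟩
    have hnl : ∀ p ∈ l.partSet, p ≤ n := fun p hp => hn p (Finset.mem_union_left _ hp)
    have hnk : ∀ p ∈ k.partSet, p ≤ n := fun p hp => hn p (Finset.mem_union_right _ hp)
    rw [l.size_eq_sum_countGE hnl, k.size_eq_sum_countGE hnk] at hs
    obtain ⟨d, hd⟩ : ∃ d : ℕ → ℕ, ∀ t, 1 ≤ t → k.countGE t = l.countGE t + d t :=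
      ⟨fun t => k.countGE t - l.countGE t, fun t ht => (Nat.add_sub_cancel' (hc t ht)).symm⟩
    rw [Finset.sum_congr rfl fun t ht => hd t (Finset.mem_Icc.1 ht).1,
      Finset.sum_add_distrib] at hs
    have hs1 : ∑ t ∈ Finset.Icc 1 n, d t = 1 := by omega
    obtain ⟨t, ht, ht0⟩ : ∃ t ∈ Finset.Icc 1 n, d t ≠ 0 := by
      by_contra! h
      rw [Finset.sum_eq_zero h] at hs1
      omega
    rw [← Finset.add_sum_erase _ _ ht] at hs1
    have ht1 : d t = 1 := by omega
    have hother : ∀ r, 1 ≤ r → r ≠ t → d r = 0 := by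
      intro r hr hrt
      by_cases hrn : r ≤ n
      · have h0 : ∑ t ∈ (Finset.Icc 1 n).erase t, d t = 0 := by omega
        exact Finset.sum_eq_zero_iff.1 h0 r (by simp [*])
      · have h0 : k.countGE r = 0 := by
          rw [countGE, Finset.card_eq_zero, Finset.filter_eq_empty_iff]
          intro p hp
          have := hnk p hp
          omega
        have := hd r hr
        omega
    rw [Finset.mem_Icc] at ht
    have hmem : t - 1 ∈ l.growable := by
      rw [mem_growable, Nat.sub_add_cancel ht.1]
      constructor
      · by_contra! h
        have h1 := l.countGE_eq_succ (t - 1)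
        have h2 := k.countGE_eq_succ (t - 1)
        rw [Nat.sub_add_cancel ht.1] at h1 h2
        rw [if_neg h.2] at h1
        have h3 := hd (t - 1) (by omega)
        have h4 := hother (t - 1) (by omega) (by omega)
        have h5 := hd t ht.1
        omega
      · intro h
        have h1 := l.countGE_eq_succ t
        have h2 := k.countGE_eq_succ t
        rw [if_pos h] at h1
        have h3 := hd (t + 1) (by omega)
        have h4 := hother (t + 1) (by omega) (by omega)
        have h5 := hd t ht.1
        split_ifs at h2 <;> omega
    refine ⟨t - 1, hmem, eq_of_countGE_eq fun r hr => ?_⟩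
    rw [countGE_addBox hmem hr, hd r hr, Nat.sub_add_cancel ht.1]
    split_ifs with h
    · rw [h, ht1]
    · rw [hother r hr h]
  · rintro ⟨p, hp, rfl⟩
    exact ⟨size_addBox hp, contained_addBox hp⟩

theorem addBox_injOn (l : StrictPartition) : Set.InjOn l.addBox l.growable := by
  intro p hp r hr h
  have h1 := countGE_addBox hp (t := p + 1) (by omega)
  rw [show l.addBox p = l.addBox r from h, countGE_addBox hr (by omega)] at h1
  split_ifs at h1 <;> omega

theorem above_one_eq (l : StrictPartition) [DecidableEq StrictPartition] :
    l.above 1 = l.growable.image l.addBox := by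
  ext k
  simp [mem_above_one]

/-- The multiplicity with which `l.addBox p` is counted by `diffOp`. -/
def growWeight (p : ℕ) : ℕ := if p = 0 then 1 else 2

theorem sum_above_one {M : Type*} [AddCommMonoid M] (l : StrictPartition)
    (g : StrictPartition → M) : ∑ k ∈ l.above 1, g k = ∑ p ∈ l.growable, g (l.addBox p) := by
  classical
  rw [above_one_eq, Finset.sum_image l.addBox_injOn]

theorem diffOp_apply {K : Type*} [Field K] (g : StrictPartition → K) (l : StrictPartition) :
    diffOp g l = ∑ p ∈ l.growable, (growWeight p : K) * g (l.addBox p) - g l := by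
  rw [diffOp, Finset.sum_filter, Finset.sum_filter, sum_above_one, sum_above_one,
    Finset.mul_sum, ← Finset.sum_add_distrib]
  congr 1
  apply Finset.sum_congr rfl
  intro p hp
  rw [length_addBox hp, growWeight]
  split_ifs <;> first | omega | simp

end StrictPartition

section Interpolation

variable {ι K : Type*} [DecidableEq ι] [Field K]

/-- The weights for which `∑ p ∈ A, interpolationWeight A S a b p / (z - a p)` is the partial
fraction expansion of `∏ q ∈ S, (z - b q) / ∏ q ∈ A, (z - a q)`. -/
def interpolationWeight (A S : Finset ι) (a b : ι → K) (p : ι) : K :=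
  (∏ q ∈ S, (a p - b q)) / ∏ q ∈ A.erase p, (a p - a q)

/-- The moments of the interpolation weights. -/
def interpolationMoment (A S : Finset ι) (a b : ι → K) (k : ℕ) : K :=
  ∑ p ∈ A, interpolationWeight A S a b p * a p ^ k

variable {A S : Finset ι} {a b : ι → K}

theorem sum_interpolationWeight_mul_prod_sub (ha : Set.InjOn a A) (hS : S.card + 1 = A.card)
    (z : K) : ∑ p ∈ A, interpolationWeight A S a b p * ∏ q ∈ A.erase p, (z - a q)
      = ∏ q ∈ S, (z - b q) := by
  have hdeg : (Lagrange.nodal S b).degree < A.card := by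
    rw [Lagrange.degree_nodal, ← hS]
    exact_mod_cast Nat.lt_succ_self _
  have h := congrArg (Polynomial.eval z) (Lagrange.eq_interpolate ha hdeg)
  rw [Lagrange.eval_nodal, Lagrange.interpolate_apply, Polynomial.eval_finsetSum] at h
  rw [h]
  apply Finset.sum_congr rfl
  intro p _
  rw [Polynomial.eval_mul, Polynomial.eval_C, Lagrange.eval_nodal, Lagrange.basis,
    Polynomial.eval_prod, interpolationWeight, div_mul_eq_mul_div, mul_div_assoc,
    ← Finset.prod_div_distrib]
  congr 1
  apply Finset.prod_congr rfl
  intro q _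
  simp [Lagrange.basisDivisor, div_eq_inv_mul]

theorem sum_interpolationWeight_mul_prod_one_sub [Infinite K] (ha : Set.InjOn a A)
    (hS : S.card + 1 = A.card) :
    ∑ p ∈ A, Polynomial.C (interpolationWeight A S a b p)
        * ∏ q ∈ A.erase p, (1 - Polynomial.C (a q) * Polynomial.X)
      = ∏ q ∈ S, (1 - Polynomial.C (b q) * Polynomial.X) := by
  have hrev : ∀ (T : Finset ι) (c : ι → K) {t : K}, t ≠ 0 →
      ∏ q ∈ T, (1 - c q * t) = t ^ T.card * ∏ q ∈ T, (t⁻¹ - c q) := by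
    intro T c t ht
    rw [← Finset.prod_const, ← Finset.prod_mul_distrib]
    apply Finset.prod_congr rfl
    intro q _
    field_simp
  apply Polynomial.eq_of_infinite_eval_eq
  apply Set.Infinite.mono (s := {0}ᶜ) _ (Set.finite_singleton (0 : K)).infinite_compl
  intro t ht
  have ht : t ≠ 0 := ht
  simp only [Set.mem_ofPred_eq, Polynomial.eval_finsetSum, Polynomial.eval_mul,
    Polynomial.eval_prod, Polynomial.eval_sub, Polynomial.eval_one, Polynomial.eval_C,
    Polynomial.eval_X]
  rw [hrev S b ht, ← sum_interpolationWeight_mul_prod_sub ha hS, Finset.mul_sum]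
  apply Finset.sum_congr rfl
  intro p hp
  rw [hrev _ a ht, Finset.card_erase_of_mem hp, ← hS, Nat.add_sub_cancel]
  ring

theorem interpolationMoment_zero (ha : Set.InjOn a A) [Infinite K] (hS : S.card + 1 = A.card) :
    interpolationMoment A S a b 0 = 1 := by
  have h := congrArg (Polynomial.eval 0) (sum_interpolationWeight_mul_prod_one_sub (b := b) ha hS)
  simpa [Polynomial.eval_finsetSum, Polynomial.eval_prod, interpolationMoment] using h

open PowerSeries in
theorem PowerSeries.one_sub_C_mul_X_mul_mk_pow (c : K) :
    (1 - C c * X) * mk (fun k => c ^ k) = 1 := by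
  ext n
  rw [sub_mul, one_mul, mul_assoc, map_sub, coeff_C_mul, coeff_mk, coeff_one]
  cases n with
  | zero => simp
  | succ n => rw [coeff_succ_X_mul, coeff_mk]; simp [pow_succ']

open PowerSeries in
theorem PowerSeries.derivative_prod_one_sub (T : Finset ι) (c : ι → K) :
    d⁄dX K (∏ q ∈ T, (1 - C (c q) * X))
      = -(∏ q ∈ T, (1 - C (c q) * X)) * mk (fun k => ∑ q ∈ T, c q ^ (k + 1)) := by
  induction T using Finset.induction_on with
  | empty =>
    have : (mk fun _ => (0 : K)) = 0 := by ext; simp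
    simp [this]
  | insert p T hp ih =>
    have h1 : (mk fun k => ∑ q ∈ insert p T, c q ^ (k + 1))
        = C (c p) * mk (fun k => c p ^ k) + mk (fun k => ∑ q ∈ T, c q ^ (k + 1)) := by
      ext n
      simp [Finset.sum_insert hp, pow_succ']
    have h2 : d⁄dX K (1 - C (c p) * X) = -C (c p) := by
      rw [map_sub, Derivation.leibniz, derivative_C, derivative_X]
      simp
    rw [Finset.prod_insert hp, Derivation.leibniz, ih, h1, h2, smul_eq_mul, smul_eq_mul]
    linear_combination (∏ q ∈ T, (1 - C (c q) * X)) * C (c p) * one_sub_C_mul_X_mul_mk_pow (c p)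

open PowerSeries in
theorem mk_interpolationMoment_mul_prod [Infinite K] (ha : Set.InjOn a A)
    (hS : S.card + 1 = A.card) :
    mk (interpolationMoment A S a b) * ∏ q ∈ A, (1 - C (a q) * X)
      = ∏ q ∈ S, (1 - C (b q) * X) := by
  have h := congrArg (Polynomial.coeToPowerSeries.ringHom (R := K))
    (sum_interpolationWeight_mul_prod_one_sub (b := b) ha hS)
  simp only [map_sum, map_mul, map_prod, map_sub, map_one,
    Polynomial.coeToPowerSeries.ringHom_apply, Polynomial.coe_C, Polynomial.coe_X] at h
  rw [← h]
  have h1 : mk (interpolationMoment A S a b)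
      = ∑ p ∈ A, C (interpolationWeight A S a b p) * mk (fun k => a p ^ k) := by
    ext n
    simp [interpolationMoment]
  rw [h1, Finset.sum_mul]
  apply Finset.sum_congr rfl
  intro p hp
  rw [← Finset.mul_prod_erase A _ hp]
  linear_combination (C (interpolationWeight A S a b p) * ∏ q ∈ A.erase p, (1 - C (a q) * X))
    * one_sub_C_mul_X_mul_mk_pow (a p)

open PowerSeries in
/-- The moments of the interpolation weights are the complete homogeneous symmetric functions of
the difference of alphabets `a - b`: they satisfy Newton's identities. -/
theorem succ_mul_interpolationMoment_succ [Infinite K] (ha : Set.InjOn a A)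
    (hS : S.card + 1 = A.card) (k : ℕ) :
    ((k : K) + 1) * interpolationMoment A S a b (k + 1)
      = ∑ x ∈ Finset.HasAntidiagonal.antidiagonal k, interpolationMoment A S a b x.1
          * (∑ q ∈ A, a q ^ (x.2 + 1) - ∑ q ∈ S, b q ^ (x.2 + 1)) := by
  set E := mk (interpolationMoment A S a b) with hE
  have h := mk_interpolationMoment_mul_prod (b := b) ha hS
  have h' := congrArg (d⁄dX K) h
  rw [Derivation.leibniz, PowerSeries.derivative_prod_one_sub,
    PowerSeries.derivative_prod_one_sub, ← h, smul_eq_mul, smul_eq_mul, ← hE] at h'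
  have hne : ∏ q ∈ A, (1 - C (a q) * X) ≠ 0 := by
    rw [Finset.prod_ne_zero_iff]
    intro q _ h0
    have := congrArg (coeff 0) h0
    simp at this
  have h2 : d⁄dX K E = E * (mk (fun k => ∑ q ∈ A, a q ^ (k + 1))
      - mk (fun k => ∑ q ∈ S, b q ^ (k + 1))) := by
    apply mul_left_cancel₀ hne
    linear_combination h'
  have h3 := congrArg (coeff k) h2
  rw [coeff_derivative, coeff_mul, hE, coeff_mk] at h3
  rw [mul_comm, h3]
  simp

end Interpolation

namespace StrictPartition

theorem part_mem (l : StrictPartition) {i : ℕ} (hi : 1 ≤ i) (hl : i ≤ l.length) :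
    l.part i ∈ l.partSet := by
  have h : i - 1 < l.parts.length := by
    have : i ≤ l.parts.length := hl
    omega
  rw [mem_partSet, part, List.getD_eq_getElem _ _ h]
  exact List.getElem_mem h

theorem part_countGE {l : StrictPartition} {p : ℕ} (hp : p ∈ l.partSet) :
    l.part (l.countGE p) = p := by
  have h0 : 1 ≤ p := l.pos p (mem_partSet.1 hp)
  have h := l.countGE_eq_succ p
  rw [if_pos hp] at h
  have h1 := (l.le_part_iff (i := l.countGE p) (by omega) h0).2 le_rfl
  have h2 := (l.le_part_iff (i := l.countGE p) (t := p + 1) (by omega) (by omega)).not.2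
    (by omega)
  omega

theorem countGE_part (l : StrictPartition) {i : ℕ} (hi : 1 ≤ i) (hl : i ≤ l.length) :
    l.countGE (l.part i) = i := by
  have h0 := (l.part_pos_iff hi).2 hl
  have h1 := (l.le_part_iff hi h0).1 le_rfl
  have h2 := (l.le_part_iff (t := l.part i + 1) hi (by omega)).not.1 (by omega)
  have h := l.countGE_eq_succ (l.part i)
  split_ifs at h <;> omega

theorem countGE_mem_Icc {l : StrictPartition} {p : ℕ} (hp : p ∈ l.partSet) :
    l.countGE p ∈ Finset.Icc 1 l.length := by
  have h0 : 1 ≤ p := l.pos p (mem_partSet.1 hp)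
  have h := l.countGE_eq_succ p
  rw [if_pos hp] at h
  rw [Finset.mem_Icc, ← countGE_one]
  exact ⟨by omega, l.countGE_antitone h0⟩

theorem part_lt_part (l : StrictPartition) {i k : ℕ} (hi : 1 ≤ i) (hik : i < k)
    (hl : i ≤ l.length) : l.part k < l.part i := by
  have h0 := (l.part_pos_iff hi).2 hl
  by_contra! h
  have h1 := (l.le_part_iff (i := k) (by omega) h0).1 h
  rw [l.countGE_part hi hl] at h1
  omega

theorem part_anti (l : StrictPartition) {i k : ℕ} (hi : 1 ≤ i) (hik : i ≤ k) :
    l.part k ≤ l.part i := by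
  rcases hik.eq_or_lt with rfl | hik
  · rfl
  · by_cases hl : i ≤ l.length
    · exact (l.part_lt_part hi hik hl).le
    · have := (l.part_pos_iff (i := k) (by omega)).not.2 (by omega)
      omega

theorem part_eq_zero (l : StrictPartition) {i : ℕ} (h : l.length < i) : l.part i = 0 := by
  have := (l.part_pos_iff (i := i) (by omega)).not.2 (by omega)
  omega

@[to_additive]
theorem prod_Icc_part {M : Type*} [CommMonoid M] (l : StrictPartition) (f : ℕ → M) :
    ∏ i ∈ Finset.Icc 1 l.length, f (l.part i) = ∏ p ∈ l.partSet, f p := by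
  refine Finset.prod_nbij' l.part l.countGE ?_ ?_ ?_ ?_ fun _ _ => rfl
  · intro i hi
    rw [Finset.mem_Icc] at hi
    exact l.part_mem hi.1 hi.2
  · exact fun p hp => countGE_mem_Icc hp
  · intro i hi
    rw [Finset.mem_Icc] at hi
    exact l.countGE_part hi.1 hi.2
  · exact fun p hp => part_countGE hp

@[to_additive]
theorem prod_diagram {M : Type*} [CommMonoid M] (l : StrictPartition) (f : ℕ × ℕ → M) :
    ∏ b ∈ l.diagram, f b
      = ∏ i ∈ Finset.Icc 1 l.length, ∏ j ∈ Finset.Icc (i + 1) (i + l.part i), f (i, j) := by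
  rw [diagram, Finset.prod_biUnion]
  · apply Finset.prod_congr rfl
    intro i _
    rw [Finset.prod_image]
    intro j _ j' _ h
    exact (Prod.mk.inj h).2
  · intro i _ i' _ hne
    rw [Function.onFun, Finset.disjoint_left]
    intro b hb hb'
    simp only [Finset.mem_image] at hb hb'
    obtain ⟨j, _, rfl⟩ := hb
    obtain ⟨j', _, h⟩ := hb'
    exact hne (Prod.mk.inj h).1.symm

theorem sum_diagram_content {M : Type*} [AddCommMonoid M] (l : StrictPartition) (f : ℕ → M) :
    ∑ b ∈ l.diagram, f (content b) = ∑ p ∈ l.partSet, ∑ t ∈ Finset.Icc 1 p, f t := by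
  rw [sum_diagram, ← sum_Icc_part]
  apply Finset.sum_congr rfl
  intro i _
  apply Finset.sum_nbij' (fun j => j - i) (fun t => t + i) <;>
    simp only [Finset.mem_Icc, content] <;> intros <;> first | omega | rfl | trivial

theorem card_diagram (l : StrictPartition) : l.diagram.card = l.size := by
  have := l.sum_diagram_content fun _ => 1
  simpa [size_eq_sum] using this

/-- The box by which the diagrams of `l` and `l.addBox p` differ. -/
def newBox (l : StrictPartition) (p : ℕ) : ℕ × ℕ :=
  (l.countGE (p + 1) + 1, l.countGE (p + 1) + 1 + (p + 1))

theorem newBox_notMem (l : StrictPartition) (p : ℕ) : l.newBox p ∉ l.diagram := by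
  rw [mem_diagram, newBox]
  simp

theorem countGE_of_mem_growable {l : StrictPartition} {p : ℕ} (hp : p ∈ l.growable) :
    l.countGE (p + 2) = l.countGE (p + 1) := by
  have := l.countGE_eq_succ (p + 1)
  rw [if_neg (mem_growable.1 hp).2] at this
  exact this.symm

theorem countGE_add_le (l : StrictPartition) (t d : ℕ) :
    l.countGE t ≤ l.countGE (t + d) + d := by
  induction d with
  | zero => rfl
  | succ d ih =>
    have := l.countGE_eq_succ (t + d)
    rw [← add_assoc t d 1]
    split_ifs at this <;> omega

theorem diagram_addBox {l : StrictPartition} {p : ℕ} (hp : p ∈ l.growable) :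
    (l.addBox p).diagram = insert (l.newBox p) l.diagram := by
  symm
  apply Finset.eq_of_subset_of_card_le
  · rw [Finset.insert_subset_iff]
    refine ⟨?_, contained_iff_diagram_subset.1 (contained_addBox hp)⟩
    rw [mem_diagram, newBox, Nat.add_sub_cancel_left, countGE_addBox hp (by omega), if_pos rfl]
    exact ⟨by simp, by simp, le_rfl⟩
  · rw [Finset.card_insert_of_notMem (l.newBox_notMem p), card_diagram, card_diagram,
      size_addBox hp]

theorem mem_outerCorners {l : StrictPartition} {b : ℕ × ℕ} :
    b ∈ l.outerCorners
      ↔ ∃ p ∈ l.partSet, p - 1 ∉ l.partSet ∧ b = (l.countGE p, l.countGE p + p) := by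
  classical
  rw [outerCorners, Finset.mem_filter]
  constructor
  · rintro ⟨hb, k, hk⟩
    have hl : l ∈ k.above 1 := by
      rw [mem_above, ← card_diagram, ← card_diagram, hk, Finset.card_erase_add_one hb,
        contained_iff_diagram_subset, hk]
      exact ⟨rfl, Finset.erase_subset _ _⟩
    obtain ⟨p, hp, rfl⟩ := mem_above_one.1 hl
    refine ⟨p + 1, by simp, ?_, ?_⟩
    · simp
    · have h : b ∉ k.diagram := by simp [hk]
      rw [diagram_addBox hp, Finset.mem_insert] at hb
      rw [countGE_addBox hp (by omega), if_pos rfl]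
      exact hb.resolve_right h
  · rintro ⟨p, hp, hp', rfl⟩
    have h1 : 1 ≤ p := l.pos p (mem_partSet.1 hp)
    obtain ⟨r, rfl⟩ : ∃ r, p = r + 1 := ⟨p - 1, by omega⟩
    rw [Nat.add_sub_cancel] at hp'
    have hk0 : 0 ∉ (insert r (l.partSet.erase (r + 1))).erase 0 := by simp
    set k := ofPartSet _ hk0 with hk
    have hkS : k.partSet = _ := partSet_ofPartSet _ hk0
    have hr : r ∈ k.growable := by
      rw [mem_growable, hkS]
      by_cases h : r = 0 <;> simp [h]
    have hkl : k.addBox r = l := by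
      apply partSet_injective
      ext t
      rw [partSet_addBox, hkS]
      simp only [Finset.mem_insert, Finset.mem_erase]
      have h0 := l.zero_notMem_partSet
      by_cases h2 : t = r
      · subst h2
        simp [hp']
      · by_cases h3 : t = r + 1
        · subst h3
          simp [hp]
        · by_cases h4 : t = 0
          · subst h4
            simp [h0]
          · simp [h2, h3, h4]
    have hb : k.newBox r = (l.countGE (r + 1), l.countGE (r + 1) + (r + 1)) := by
      rw [newBox, ← hkl, countGE_addBox hr (by omega), if_pos rfl]
    have hd : l.diagram = insert (k.newBox r) k.diagram := by
      rw [← diagram_addBox hr, hkl]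
    rw [← hb, hd]
    exact ⟨Finset.mem_insert_self _ _, k, by rw [Finset.erase_insert (k.newBox_notMem r)]⟩

theorem mem_image_fst_outerCorners {l : StrictPartition} {i : ℕ} :
    i ∈ l.outerCorners.image Prod.fst
      ↔ i ∈ Finset.Icc 1 l.length ∧ l.part i - 1 ∉ l.partSet := by
  simp only [Finset.mem_image, mem_outerCorners]
  constructor
  · rintro ⟨_, ⟨p, hp, hp', rfl⟩, rfl⟩
    exact ⟨countGE_mem_Icc hp, by rwa [part_countGE hp]⟩
  · rintro ⟨hi, hi'⟩
    rw [Finset.mem_Icc] at hi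
    exact ⟨_, ⟨l.part i, l.part_mem hi.1 hi.2, hi', rfl⟩, l.countGE_part hi.1 hi.2⟩

/-- The strict partition formed by the rows of the outer corners. -/
noncomputable def rowPartition (l : StrictPartition) : StrictPartition :=
  ofPartSet (l.outerCorners.image Prod.fst) 
    fun h => by simpa using (mem_image_fst_outerCorners.1 h).1

theorem cornerRow_eq (l : StrictPartition) (j : ℕ) : l.cornerRow j = l.rowPartition.part j :=
  rfl

theorem mem_partSet_rowPartition {l : StrictPartition} {i : ℕ} :
    i ∈ l.rowPartition.partSet ↔ i ∈ Finset.Icc 1 l.length ∧ l.part i - 1 ∉ l.partSet := by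
  rw [rowPartition, partSet_ofPartSet, mem_image_fst_outerCorners]

theorem numCorners_eq (l : StrictPartition) : l.numCorners = l.rowPartition.length := by
  rw [length_eq_card, rowPartition, partSet_ofPartSet, Finset.card_image_of_injOn, numCorners]
  intro b hb b' hb' h
  obtain ⟨p, hp, _, rfl⟩ := mem_outerCorners.1 hb
  obtain ⟨p', hp', _, rfl⟩ := mem_outerCorners.1 hb'
  simp only at h
  rw [← part_countGE hp, ← part_countGE hp', h]

theorem notMem_of_part_lt {l : StrictPartition} {i r : ℕ} (hi : 1 ≤ i) (h1 : l.part (i + 1) < r)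
    (h2 : r < l.part i) : r ∉ l.partSet := by
  intro hr
  have h3 := (l.le_part_iff (t := r) (i := i + 1) (by omega) (by omega)).not.1 (by omega)
  have h4 := (l.le_part_iff (t := r + 1) (i := i) hi (by omega)).1 (by omega)
  have h := l.countGE_eq_succ r
  rw [if_pos hr] at h
  omega

theorem rowPartition_part_one (l : StrictPartition) : l.rowPartition.part 1 = l.length := by
  apply le_antisymm
  · by_cases h : 1 ≤ l.rowPartition.length
    · exact (Finset.mem_Icc.1 (mem_partSet_rowPartition.1 (part_mem _ le_rfl h)).1).2
    · rw [part_eq_zero _ (by omega)]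
      omega
  · rcases Nat.eq_zero_or_pos l.length with h0 | h0
    · omega
    · have hmem : l.length ∈ l.rowPartition.partSet := by
        rw [mem_partSet_rowPartition, Finset.mem_Icc]
        refine ⟨⟨h0, le_rfl⟩, fun h => ?_⟩
        have h1 : 0 < l.part l.length - 1 := l.pos _ (mem_partSet.1 h)
        have h2 := (l.le_part_iff (i := l.countGE (l.part l.length - 1)) (t := l.part l.length)
          (Finset.mem_Icc.1 (countGE_mem_Icc h)).1 (by omega)).2 (by
            rw [l.countGE_part h0 le_rfl]
            exact (Finset.mem_Icc.1 (countGE_mem_Icc h)).2)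
        rw [part_countGE h] at h2
        omega
      rw [le_part_iff _ le_rfl h0]
      exact (Finset.mem_Icc.1 (countGE_mem_Icc hmem)).1

theorem part_succ_of_notMem_rowPartition {l : StrictPartition} {i : ℕ}
    (hi : i ∈ Finset.Icc 1 l.length) (h : i ∉ l.rowPartition.partSet) :
    l.part i = l.part (i + 1) + 1 := by
  rw [mem_partSet_rowPartition, not_and_not_right] at h
  have h1 := h hi
  rw [Finset.mem_Icc] at hi
  have h2 := (l.part_pos_iff hi.1).2 hi.2
  have h3 := l.countGE_eq_succ (l.part i - 1)
  rw [if_pos h1, Nat.sub_add_cancel h2, l.countGE_part hi.1 hi.2] at h3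
  have h4 := part_countGE h1
  rw [h3] at h4
  omega

theorem part_eq_of_mem_Ioc (l : StrictPartition) {i r : ℕ} (hi : 1 ≤ i)
    (hr : r ∈ Finset.Ioc (l.rowPartition.part (i + 1)) (l.rowPartition.part i)) :
    l.part r + r = l.part (l.rowPartition.part i) + l.rowPartition.part i := by
  rw [Finset.mem_Ioc] at hr
  have hle : l.rowPartition.part i ≤ l.length := by
    rw [← rowPartition_part_one]
    exact part_anti _ le_rfl hi
  induction hd : l.rowPartition.part i - r generalizing r with
  | zero =>
    have : r = l.rowPartition.part i := by omega
    rw [this]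
  | succ d ih =>
    rw [← ih (r := r + 1) (by omega) (by omega), part_succ_of_notMem_rowPartition (i := r)
      (Finset.mem_Icc.2 (by omega)) (notMem_of_part_lt hi hr.1 (by omega))]
    ring

theorem sum_Ioc_sub_telescope {M : Type*} [AddCommGroup M] (f : ℕ → M) {a b c : ℕ} (hab : a ≤ b)
    (hbc : b ≤ c) :
    ∑ r ∈ Finset.Ioc a b, (f (c - r + 1) - f (c - r)) = f (c - a) - f (c - b) := by
  induction b, hab using Nat.le_induction with
  | base => simp
  | succ b hab ih =>
    rw [Finset.sum_Ioc_succ_top hab, ih (by omega), show c - (b + 1) + 1 = c - b by omega]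
    abel

theorem sum_corners {M : Type*} [AddCommGroup M] (l : StrictPartition) (f : ℕ → M) :
    ∑ i ∈ Finset.range (l.numCorners + 1), f (l.innerContent i)
        - ∑ j ∈ Finset.Icc 1 l.numCorners, f (l.outerContent j)
      = f 1 + ∑ p ∈ l.partSet, (f (p + 1) - f p) := by
  set A : ℕ → ℕ := fun i => l.rowPartition.part (i + 1) with hA
  have hanti : ∀ i, A (i + 1) ≤ A i := fun i => part_anti _ (by omega) (by omega)
  have h0 : l.innerContent 0 = 1 := by
    simp [innerContent, content, cornerCol, cornerRow_eq, rowPartition_part_one]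
  have hin : ∀ i, l.innerContent (i + 1) = A i + l.part (A i) - A (i + 1) := fun i => rfl
  have hout : ∀ i, l.outerContent (i + 1) = l.part (A i) := by
    intro i
    exact Nat.add_sub_cancel_left (A i) (l.part (A i))
  have hIcc : ∑ j ∈ Finset.Icc 1 l.numCorners, f (l.outerContent j)
      = ∑ i ∈ Finset.range l.numCorners, f (l.outerContent (i + 1)) := by
    rw [Finset.range_eq_Ico, Finset.sum_Ico_add' (fun i => f (l.outerContent i)) 0 _ 1]
    rfl
  have hblock : ∀ i, f (l.innerContent (i + 1)) - f (l.outerContent (i + 1))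
      = ∑ r ∈ Finset.Ioc (A (i + 1)) (A i), (f (l.part r + 1) - f (l.part r)) := by
    intro i
    have := sum_Ioc_sub_telescope f (hanti i) (c := A i + l.part (A i)) (by omega)
    rw [Nat.add_sub_cancel_left] at this
    rw [hin, hout, ← this]
    apply Finset.sum_congr rfl
    intro r hr
    have h := l.part_eq_of_mem_Ioc (i := i + 1) (by omega) hr
    have h' : A i + l.part (A i) - r = l.part r := by
      simp only [hA]
      omega
    rw [h']
  have hsum : ∀ n, ∑ i ∈ Finset.range n,
      ∑ r ∈ Finset.Ioc (A (i + 1)) (A i), (f (l.part r + 1) - f (l.part r))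
        = ∑ r ∈ Finset.Ioc (A n) (A 0), (f (l.part r + 1) - f (l.part r)) := by
    intro n
    induction n with
    | zero => simp
    | succ n ih =>
      rw [Finset.sum_range_succ, ih, add_comm,
        Finset.sum_Ioc_consecutive _ (hanti n) (antitone_nat_of_succ_le hanti (Nat.zero_le n))]
  have hm : A l.numCorners = 0 := part_eq_zero _ (by rw [numCorners_eq]; omega)
  have hA0 : A 0 = l.length := l.rowPartition_part_one
  rw [Finset.sum_range_succ', h0, hIcc, add_sub_right_comm, ← Finset.sum_sub_distrib,
    Finset.sum_congr rfl fun i _ => hblock i, hsum, hm, hA0,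
    ← l.sum_Icc_part fun p => f (p + 1) - f p, add_comm]
  rfl

variable {K : Type*} [Field K]

theorem q_eq (k : ℕ) (l : StrictPartition) :
    q K k l = 0 ^ k + ∑ p ∈ l.partSet, (((p + 1).choose 2 : K) ^ k - (p.choose 2 : K) ^ k) := by
  have := l.sum_corners fun t => (t.choose 2 : K) ^ k
  simpa [q] using this

end StrictPartition

namespace StrictPartition

theorem add_part_anti (l : StrictPartition) {i k : ℕ} (hi : 1 ≤ i) (hik : i ≤ k)
    (hk : k ≤ l.length) : k + l.part k ≤ i + l.part i := by
  induction k, hik using Nat.le_induction with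
  | base => rfl
  | succ k hik ih =>
    have := l.part_lt_part (i := k) (k := k + 1) (by omega) (by omega) (by omega)
    have := ih (by omega)
    omega

theorem length_lt_add_part (l : StrictPartition) {i : ℕ} (hi : 1 ≤ i) (hl : i ≤ l.length) :
    l.length < i + l.part i := by
  have := l.add_part_anti hi hl le_rfl
  have := (l.part_pos_iff (i := l.length) (by omega)).2 le_rfl
  omega

theorem card_arm (l : StrictPartition) {i : ℕ} (hi : 1 ≤ i) {j : ℕ} (hj : i < j) :
    (l.diagram.filter fun c => c.1 = i ∧ j < c.2).card = i + l.part i - j := by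
  rw [← Nat.card_Ioc, ← Finset.card_image_of_injective (Finset.Ioc j (i + l.part i))
    (Prod.mk_right_injective i)]
  congr 1
  ext ⟨a, b⟩
  simp only [Finset.mem_filter, mem_diagram_iff_le_part, Finset.mem_image, Finset.mem_Ioc,
    Prod.mk.injEq]
  constructor
  · rintro ⟨h, rfl, h'⟩
    exact ⟨b, ⟨h', h.2.2⟩, rfl, rfl⟩
  · rintro ⟨b, h, rfl, rfl⟩
    exact ⟨⟨hi, by omega, h.2⟩, rfl, h.1⟩

theorem card_leg (l : StrictPartition) {i : ℕ} (hi : 1 ≤ i) (j : ℕ) :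
    (l.diagram.filter fun c => c.2 = j ∧ i < c.1).card
      = ((Finset.Ioc i l.length).filter fun k => k < j ∧ j ≤ k + l.part k).card := by
  rw [← Finset.card_image_of_injective (Finset.filter _ (Finset.Ioc i l.length))
    (Prod.mk_left_injective j)]
  apply congrArg Finset.card
  ext ⟨a, b⟩
  simp only [Finset.mem_filter, mem_diagram_iff_le_part, Finset.mem_image, Finset.mem_Ioc,
    Prod.mk.injEq]
  constructor
  · rintro ⟨h, rfl, h'⟩
    exact ⟨a, ⟨⟨h', (l.part_pos_iff h.1).1 (by omega)⟩, h.2⟩, rfl, rfl⟩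
  · rintro ⟨a, h, rfl, rfl⟩
    exact ⟨⟨by omega, h.2⟩, rfl, h.1.1⟩

theorem hookLength_of_le (l : StrictPartition) {i j : ℕ} (hi : 1 ≤ i) (hij : i < j)
    (hj : j ≤ l.length) : l.hookLength (i, j) = l.part i + l.part j := by
  have h1 : ((Finset.Ioc i l.length).filter fun k => k < j ∧ j ≤ k + l.part k)
      = Finset.Ioo i j := by
    ext k
    simp only [Finset.mem_filter, Finset.mem_Ioc, Finset.mem_Ioo]
    constructor
    · rintro ⟨⟨h1, _⟩, h2, _⟩
      exact ⟨h1, h2⟩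
    · rintro ⟨h1, h2⟩
      have := l.length_lt_add_part (i := k) (by omega) (by omega)
      omega
  rw [hookLength, l.card_arm hi hij, l.card_leg hi, h1, Nat.card_Ioo]
  have := l.length_lt_add_part hi (by omega)
  simp only
  omega

/-- The leg of the box `(i, j)`, for a column `j` larger than the number of rows. -/
def leg (l : StrictPartition) (i j : ℕ) : ℕ :=
  ((Finset.Ioc i l.length).filter fun k => j ≤ k + l.part k).card

theorem le_add_part_iff_le_leg (l : StrictPartition) {i j k : ℕ}
    (hk : k ∈ Finset.Ioc i l.length) : j ≤ k + l.part k ↔ k ≤ i + l.leg i j := by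
  rw [Finset.mem_Ioc] at hk
  constructor
  · intro h
    have : Finset.Ioc i k ⊆ (Finset.Ioc i l.length).filter fun k => j ≤ k + l.part k := by
      intro r hr
      rw [Finset.mem_Ioc] at hr
      rw [Finset.mem_filter, Finset.mem_Ioc]
      have := l.add_part_anti (i := r) (k := k) (by omega) hr.2 hk.2
      omega
    have := Finset.card_le_card this
    rw [Nat.card_Ioc] at this
    rw [leg]
    omega
  · contrapose!
    intro h
    have : ((Finset.Ioc i l.length).filter fun k => j ≤ k + l.part k) ⊆ Finset.Ioo i k := by
      intro r hr
      rw [Finset.mem_filter, Finset.mem_Ioc] at hr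
      rw [Finset.mem_Ioo]
      by_contra! hrk
      have := l.add_part_anti (i := k) (k := r) (by omega) (by omega) hr.1.2
      omega
    have := Finset.card_le_card this
    rw [Nat.card_Ioo] at this
    rw [leg]
    omega

theorem leg_le (l : StrictPartition) (i j : ℕ) : l.leg i j ≤ l.length - i := by
  rw [← Nat.card_Ioc]
  exact Finset.card_filter_le _ _

theorem leg_anti (l : StrictPartition) (i : ℕ) : Antitone (l.leg i) := fun _ _ h =>
  Finset.card_le_card (Finset.monotone_filter_right _ fun _ _ hk => h.trans hk)

theorem hookLength_of_lt (l : StrictPartition) {i j : ℕ} (hi : 1 ≤ i) (hij : i < j)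
    (hj : l.length < j) : l.hookLength (i, j) = i + l.part i - j + l.leg i j + 1 := by
  have h1 : ((Finset.Ioc i l.length).filter fun k => k < j ∧ j ≤ k + l.part k)
      = (Finset.Ioc i l.length).filter fun k => j ≤ k + l.part k := by
    apply Finset.filter_congr
    intro k hk
    rw [Finset.mem_Ioc] at hk
    omega
  rw [hookLength, l.card_arm hi hij, l.card_leg hi, h1, l.part_eq_zero hj]
  rfl

theorem prod_Icc_id_eq_factorial (n : ℕ) : ∏ x ∈ Finset.Icc 1 n, x = n.factorial := by
  induction n with
  | zero => rfl
  | succ n ih => rw [Finset.prod_Icc_succ_top (by omega), ih, Nat.factorial_succ, mul_comm]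

theorem prod_hookLength_mul_prod_sub (l : StrictPartition) {i : ℕ} (hi : 1 ≤ i)
    (hl : i ≤ l.length) :
    (∏ j ∈ Finset.Ioc l.length (i + l.part i), l.hookLength (i, j))
        * ∏ k ∈ Finset.Ioc i l.length, (l.part i - l.part k) = (l.part i).factorial := by
  have hll := l.length_lt_add_part hi hl
  have hinj1 : Set.InjOn (fun j => l.hookLength (i, j))
      (Finset.Ioc l.length (i + l.part i)) := by
    intro j hj j' hj' h
    simp only [Finset.coe_Ioc, Set.mem_Ioc] at hj hj' h
    rw [l.hookLength_of_lt hi (by omega) hj.1, l.hookLength_of_lt hi (by omega) hj'.1] at h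
    rcases le_total j j' with h' | h' <;> have := l.leg_anti i h' <;> omega
  have hinj2 : Set.InjOn (fun k => l.part i - l.part k) (Finset.Ioc i l.length) := by
    intro k hk k' hk' h
    simp only [Finset.coe_Ioc, Set.mem_Ioc] at hk hk' h
    have h1 := l.part_lt_part hi hk.1 hl
    have h2 := l.part_lt_part hi hk'.1 hl
    rcases lt_trichotomy k k' with h' | h' | h'
    · have := l.part_lt_part (by omega) h' hk.2
      omega
    · exact h'
    · have := l.part_lt_part (by omega) h' hk'.2
      omega
  have hdisj : Disjoint
      ((Finset.Ioc l.length (i + l.part i)).image fun j => l.hookLength (i, j))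
      ((Finset.Ioc i l.length).image fun k => l.part i - l.part k) := by
    rw [Finset.disjoint_left]
    intro x hx hx'
    obtain ⟨j, hj, rfl⟩ := Finset.mem_image.1 hx
    obtain ⟨k, hk, h⟩ := Finset.mem_image.1 hx'
    have h1 := l.le_add_part_iff_le_leg (j := j) hk
    rw [Finset.mem_Ioc] at hj hk
    rw [l.hookLength_of_lt hi (by omega) hj.1] at h
    have h2 := l.part_lt_part hi hk.1 hl
    omega
  have hunion : ((Finset.Ioc l.length (i + l.part i)).image fun j => l.hookLength (i, j))
      ∪ ((Finset.Ioc i l.length).image fun k => l.part i - l.part k)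
        = Finset.Icc 1 (l.part i) := by
    apply Finset.eq_of_subset_of_card_le
    · intro x hx
      rw [Finset.mem_Icc]
      rcases Finset.mem_union.1 hx with hx | hx <;> obtain ⟨j, hj, rfl⟩ := Finset.mem_image.1 hx
      · rw [Finset.mem_Ioc] at hj
        rw [l.hookLength_of_lt hi (by omega) hj.1]
        have := l.leg_le i j
        omega
      · rw [Finset.mem_Ioc] at hj
        have := l.part_lt_part hi hj.1 hl
        omega
    · rw [Finset.card_union_of_disjoint hdisj, Finset.card_image_of_injOn hinj1,
        Finset.card_image_of_injOn hinj2]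
      simp only [Nat.card_Icc, Nat.card_Ioc]
      omega
  rw [← Finset.prod_image hinj1 (f := fun x => x), ← Finset.prod_image hinj2 (f := fun x => x),
    ← Finset.prod_union hdisj, hunion, prod_Icc_id_eq_factorial]

theorem prod_hookLength_row (l : StrictPartition) {i : ℕ} (hi : 1 ≤ i) (hl : i ≤ l.length) :
    (∏ j ∈ Finset.Icc (i + 1) (i + l.part i), l.hookLength (i, j))
        * ∏ k ∈ Finset.Ioc i l.length, (l.part i - l.part k)
      = (l.part i).factorial * ∏ k ∈ Finset.Ioc i l.length, (l.part i + l.part k) := by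
  have hll := l.length_lt_add_part hi hl
  have h1 : Finset.Icc (i + 1) (i + l.part i) = Finset.Ioc i (i + l.part i) := by
    ext
    simp
  have h2 : ∏ j ∈ Finset.Ioc i l.length, l.hookLength (i, j)
      = ∏ k ∈ Finset.Ioc i l.length, (l.part i + l.part k) := by
    apply Finset.prod_congr rfl
    intro j hj
    rw [Finset.mem_Ioc] at hj
    exact l.hookLength_of_le hi hj.1 hj.2
  rw [h1, ← Finset.prod_Ioc_consecutive _ hl hll.le, h2, mul_assoc,
    l.prod_hookLength_mul_prod_sub hi hl, mul_comm]

section HookFormula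

variable (K : Type*) [Field K]

/-- The closed form of the hook product in terms of the set of parts. -/
def hookFormula (S : Finset ℕ) : K :=
  ∏ p ∈ S, ((p.factorial : K) * ∏ q ∈ S.filter (· < p), ((p : K) + q) / ((p : K) - q))

theorem hookProduct_eq [CharZero K] (l : StrictPartition) :
    (l.hookProduct : K) = hookFormula K l.partSet := by
  rw [hookProduct, prod_diagram, hookFormula, ← prod_Icc_part, Nat.cast_prod]
  apply Finset.prod_congr rfl
  intro i hi
  rw [Finset.mem_Icc] at hi
  have hlt : ∀ k ∈ Finset.Ioc i l.length, l.part k < l.part i := fun k hk =>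
    l.part_lt_part hi.1 (Finset.mem_Ioc.1 hk).1 hi.2
  have h1 : ∏ q ∈ l.partSet.filter (· < l.part i),
        ((l.part i : K) + q) / ((l.part i : K) - q)
      = ∏ k ∈ Finset.Ioc i l.length,
        ((l.part i : K) + l.part k) / ((l.part i : K) - l.part k) := by
    rw [Finset.prod_filter, ← prod_Icc_part, ← Finset.prod_filter]
    apply Finset.prod_congr _ fun _ _ => rfl
    ext k
    simp only [Finset.mem_filter, Finset.mem_Icc, Finset.mem_Ioc]
    constructor
    · rintro ⟨hk, h⟩
      refine ⟨?_, hk.2⟩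
      by_contra! hki
      have := l.part_anti hk.1 hki
      omega
    · intro hk
      exact ⟨⟨by omega, hk.2⟩, hlt k (Finset.mem_Ioc.2 hk)⟩
  have h2 := congrArg (Nat.cast (R := K)) (l.prod_hookLength_row hi.1 hi.2)
  push_cast at h2
  have h3 : ∏ k ∈ Finset.Ioc i l.length, ((l.part i - l.part k : ℕ) : K)
      = ∏ k ∈ Finset.Ioc i l.length, ((l.part i : K) - l.part k) :=
    Finset.prod_congr rfl fun k hk => Nat.cast_sub (hlt k hk).le
  have h4 : ∏ k ∈ Finset.Ioc i l.length, ((l.part i : K) - l.part k) ≠ 0 := by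
    rw [Finset.prod_ne_zero_iff]
    intro k hk
    rw [sub_ne_zero]
    exact_mod_cast (hlt k hk).ne'
  rw [h3] at h2
  rw [h1, Finset.prod_div_distrib, ← mul_div_assoc, eq_div_iff h4, ← h2, Nat.cast_prod]

theorem hookFormula_insert {S : Finset ℕ} {p : ℕ} (hp : p ∉ S) :
    hookFormula K (insert p S) = hookFormula K S * ((p.factorial : K)
      * ∏ q ∈ S, ((p : K) + q) / if q < p then (p : K) - q else (q : K) - p) := by
  have h1 : ∀ r ∈ S, (∏ q ∈ (insert p S).filter (· < r), ((r : K) + q) / ((r : K) - q))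
      = (∏ q ∈ S.filter (· < r), ((r : K) + q) / ((r : K) - q))
        * if p < r then ((r : K) + p) / ((r : K) - p) else 1 := by
    intro r _
    rw [Finset.filter_insert]
    split_ifs with h
    · rw [Finset.prod_insert (by simp [hp]), mul_comm]
    · rw [mul_one]
  have h2 : (insert p S).filter (· < p) = S.filter (· < p) := by
    rw [Finset.filter_insert, if_neg (lt_irrefl p)]
  have h3 : ∏ r ∈ S, ((r.factorial : K)
        * ∏ q ∈ (insert p S).filter (· < r), ((r : K) + q) / ((r : K) - q))
      = hookFormula K S * ∏ r ∈ S, if p < r then ((r : K) + p) / ((r : K) - p) else 1 := by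
    rw [hookFormula, ← Finset.prod_mul_distrib]
    exact Finset.prod_congr rfl fun r hr => by rw [h1 r hr, mul_assoc]
  have h4 : (∏ q ∈ S, if q < p then ((p : K) + q) / ((p : K) - q) else 1)
        * (∏ r ∈ S, if p < r then ((r : K) + p) / ((r : K) - p) else 1)
      = ∏ q ∈ S, ((p : K) + q) / if q < p then (p : K) - q else (q : K) - p := by
    rw [← Finset.prod_mul_distrib]
    apply Finset.prod_congr rfl
    intro q hq
    have hne : q ≠ p := fun h => hp (h ▸ hq)
    split_ifs with h h' h'
    · omega
    · rw [mul_one]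
    · rw [one_mul, add_comm]
    · omega
  rw [hookFormula, Finset.prod_insert hp, h2, h3, Finset.prod_filter]
  linear_combination (p.factorial : K) * hookFormula K S * h4

theorem hookProduct_ne_zero [CharZero K] (l : StrictPartition) : (l.hookProduct : K) ≠ 0 := by
  rw [hookProduct, Nat.cast_prod, Finset.prod_ne_zero_iff]
  intro b _
  have : l.hookLength b ≠ 0 := by
    rw [hookLength]
    omega
  exact_mod_cast this

/-- The coefficient of `l.addBox p` in `diffOp`, normalized by the hook products. -/
noncomputable def growRatio (l : StrictPartition) (p : ℕ) : K :=
  interpolationWeight (insert 0 l.partSet) l.partSet (fun q => ((q + 1).choose 2 : K))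
    (fun q => (q.choose 2 : K)) p

theorem growRatio_eq_zero {l : StrictPartition} {p : ℕ} (hp : p + 1 ∈ l.partSet) :
    growRatio K l p = 0 := by
  rw [growRatio, interpolationWeight, Finset.prod_eq_zero hp (sub_self _), zero_div]

theorem growRatio_eq [CharZero K] {l : StrictPartition} {p : ℕ} (hp : p ∈ l.growable) :
    growRatio K l p
      = (growWeight p : K) * (l.hookProduct : K) / ((l.addBox p).hookProduct : K) := by
  have hp' := mem_growable.1 hp
  have hne := hookProduct_ne_zero K l
  have hne' := hookProduct_ne_zero K (l.addBox p)
  rw [hookProduct_eq] at hne hne' ⊢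
  rw [hookProduct_eq]
  rw [partSet_addBox, hookFormula_insert K fun h => hp'.2 (Finset.mem_of_mem_erase h)] at hne' ⊢
  rw [growRatio, interpolationWeight]
  by_cases hp0 : p = 0
  · subst hp0
    rw [Finset.erase_eq_of_notMem l.zero_notMem_partSet] at hne' ⊢
    rw [Finset.erase_insert l.zero_notMem_partSet, growWeight, if_pos rfl,
      ← Finset.prod_div_distrib]
    rw [eq_div_iff hne', mul_left_comm, Nat.cast_one, one_mul]
    refine (mul_eq_left₀ hne).2 ?_
    rw [zero_add, Nat.factorial_one, Nat.cast_one, one_mul, ← Finset.prod_mul_distrib]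
    apply Finset.prod_eq_one
    intro q hq
    have h1 : q ≠ 0 := fun h => l.zero_notMem_partSet (h ▸ hq)
    have h2 : q ≠ 1 := fun h => hp'.2 (by rwa [zero_add, ← h])
    have h3 : (q : K) ≠ 0 := by exact_mod_cast h1
    have h4 : (q : K) - 1 ≠ 0 := sub_ne_zero.2 (by exact_mod_cast h2)
    have h5 : (q : K) + 1 ≠ 0 := by exact_mod_cast q.succ_ne_zero
    rw [if_neg (by omega), Nat.cast_choose_two, Nat.cast_choose_two, Nat.cast_choose_two]
    push_cast
    field_simp
    ring
  · have hpS := hp'.1.resolve_left hp0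
    have hpT : p ∉ l.partSet.erase p := Finset.notMem_erase _ _
    rw [← Finset.insert_erase hpS, hookFormula_insert K hpT] at hne
    rw [growWeight, if_neg hp0]
    conv_rhs => rw [← Finset.insert_erase hpS, Finset.erase_insert hpT, hookFormula_insert K hpT]
    rw [← Finset.mul_prod_erase l.partSet _ hpS, Finset.erase_insert_of_ne (Ne.symm hp0),
      Finset.prod_insert (by simp [l.zero_notMem_partSet])]
    set T := l.partSet.erase p with hT
    have h0 : hookFormula K T ≠ 0 := left_ne_zero_of_mul hne
    have hprod : (∏ q ∈ T, (((p + 1).choose 2 : K) - (q.choose 2 : K)))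
          / ∏ q ∈ T, (((p + 1).choose 2 : K) - ((q + 1).choose 2 : K))
        = (∏ q ∈ T, ((p : K) + q) / if q < p then (p : K) - q else (q : K) - p)
          / ∏ q ∈ T, (((p + 1 : ℕ) : K) + q)
            / if q < p + 1 then ((p + 1 : ℕ) : K) - q else (q : K) - (p + 1 : ℕ) := by
      rw [← Finset.prod_div_distrib, ← Finset.prod_div_distrib]
      apply Finset.prod_congr rfl
      intro q hq
      rw [hT, Finset.mem_erase] at hq
      have h1 : q ≠ p + 1 := fun h => hp'.2 (h ▸ hq.2)
      have h2 : (p : K) - q ≠ 0 := sub_ne_zero.2 (by exact_mod_cast hq.1.symm)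
      have h3 : (p : K) + 1 - q ≠ 0 := sub_ne_zero.2 (by exact_mod_cast h1.symm)
      have h4 : (p : K) + q + 1 ≠ 0 := by exact_mod_cast (p + q).succ_ne_zero
      have h2' : (q : K) - p ≠ 0 := sub_ne_zero.2 (by exact_mod_cast hq.1)
      have h3' : (q : K) - (p + 1) ≠ 0 := sub_ne_zero.2 (by exact_mod_cast h1)
      have h5 : (p : K) + 1 + q ≠ 0 := by rwa [add_right_comm]
      have h6 : ((p + 1).choose 2 : K) - ((q + 1).choose 2 : K)
          = ((p : K) - q) * (p + q + 1) / 2 := by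
        rw [Nat.cast_choose_two, Nat.cast_choose_two]
        push_cast
        ring
      have h7 : ((p + 1).choose 2 : K) - (q.choose 2 : K)
          = ((p : K) + 1 - q) * (p + q) / 2 := by
        rw [Nat.cast_choose_two, Nat.cast_choose_two]
        push_cast
        ring
      rw [h6, h7]
      push_cast
      split_ifs with h h' h'
      · field_simp
        ring
      · omega
      · omega
      · rw [← neg_sub (p : K) q, ← neg_sub ((p : K) + 1) q]
        field_simp
        ring
    have hp1 : (p : K) + 1 ≠ 0 := by exact_mod_cast p.succ_ne_zero
    have hp2 : (p : K) ≠ 0 := by exact_mod_cast hp0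
    have hfac : (p.factorial : K) ≠ 0 := by exact_mod_cast p.factorial_ne_zero
    rw [mul_div_mul_comm, hprod, mul_div_assoc, mul_div_mul_left _ _ h0, mul_div_mul_comm,
      ← mul_assoc]
    congr 1
    rw [Nat.factorial_succ, Nat.cast_choose_two, Nat.cast_choose_two, Nat.cast_choose_two]
    push_cast
    field_simp
    ring

end HookFormula

end StrictPartition

namespace StrictPartition

variable {K : Type*} [Field K]

/-- The power sums of the values `binom(c, 2)` over the contents `c` of the boxes. -/
noncomputable def contentPowerSum (K : Type*) [Field K] (k : ℕ) (l : StrictPartition) : K :=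
  ∑ b ∈ l.diagram, ((content b).choose 2 : K) ^ k

theorem contentPowerSum_addBox (k : ℕ) {l : StrictPartition} {p : ℕ} (hp : p ∈ l.growable) :
    contentPowerSum K k (l.addBox p) = contentPowerSum K k l + ((p + 1).choose 2 : K) ^ k := by
  rw [contentPowerSum, diagram_addBox hp, Finset.sum_insert (l.newBox_notMem p), add_comm,
    newBox, content, Nat.add_sub_cancel_left, contentPowerSum]

theorem q_addBox (k : ℕ) {l : StrictPartition} {p : ℕ} (hp : p ∈ l.growable) :
    q K k (l.addBox p) = q K k l + (((p + 2).choose 2 : K) ^ k + (p.choose 2 : K) ^ k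
      - 2 * ((p + 1).choose 2 : K) ^ k) := by
  rw [q_eq, q_eq, sum_partSet_addBox hp _ (by simp)]
  ring

theorem sum_growRatio_mul (l : StrictPartition) (h : ℕ → K) :
    ∑ p ∈ l.growable, growRatio K l p * h p
      = ∑ p ∈ insert 0 l.partSet, growRatio K l p * h p := by
  rw [growable, Finset.sum_filter]
  apply Finset.sum_congr rfl
  intro p _
  by_cases hp : p + 1 ∈ l.partSet
  · rw [if_neg (not_not.2 hp), growRatio_eq_zero K hp, zero_mul]
  · rw [if_pos hp]

/-- The moments of the values `binom(c, 2)` for the content `c` of a new box. -/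
noncomputable def growMoment (K : Type*) [Field K] (k : ℕ) (l : StrictPartition) : K :=
  ∑ p ∈ l.growable, growRatio K l p * ((p + 1).choose 2 : K) ^ k

theorem growMoment_eq (k : ℕ) (l : StrictPartition) :
    growMoment K k l = interpolationMoment (insert 0 l.partSet) l.partSet
      (fun q => ((q + 1).choose 2 : K)) (fun q => (q.choose 2 : K)) k :=
  l.sum_growRatio_mul _

theorem succ_choose_two_strictMono : StrictMono fun p : ℕ => (p + 1).choose 2 := by
  apply strictMono_nat_of_lt_succ
  intro p
  have : (p + 1 + 1).choose 2 = (p + 1).choose 1 + (p + 1).choose 2 :=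
    Nat.choose_succ_succ' (p + 1) 1
  rw [Nat.choose_one_right] at this
  change (p + 1).choose 2 < (p + 1 + 1).choose 2
  omega

section CharZero

variable [CharZero K]

theorem succ_choose_two_injective : Function.Injective fun p : ℕ => ((p + 1).choose 2 : K) :=
  fun _ _ h => succ_choose_two_strictMono.injective (Nat.cast_injective h)

theorem growMoment_zero (l : StrictPartition) : growMoment K 0 l = 1 := by
  rw [growMoment_eq]
  exact interpolationMoment_zero succ_choose_two_injective.injOn
    (Finset.card_insert_of_notMem l.zero_notMem_partSet).symm

theorem succ_mul_growMoment_succ (k : ℕ) (l : StrictPartition) :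
    ((k : K) + 1) * growMoment K (k + 1) l
      = ∑ x ∈ Finset.HasAntidiagonal.antidiagonal k, growMoment K x.1 l * q K (x.2 + 1) l := by
  rw [growMoment_eq, succ_mul_interpolationMoment_succ succ_choose_two_injective.injOn
    (Finset.card_insert_of_notMem l.zero_notMem_partSet).symm]
  apply Finset.sum_congr rfl
  intro x _
  rw [growMoment_eq, q_eq, Finset.sum_insert l.zero_notMem_partSet, Finset.sum_sub_distrib]
  simp

end CharZero

/-- The increasing filtration of the algebra of functions generated by the functions `q K k`, of
degree `k`, and `contentPowerSum K k`, of degree `k + 1`. -/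
inductive DegreeLE : ℕ → (StrictPartition → K) → Prop
  | const (c : K) : DegreeLE 0 fun _ => c
  | q (k : ℕ) : DegreeLE k (q K k)
  | contentPowerSum (k : ℕ) : DegreeLE (k + 1) (contentPowerSum K k)
  | add {d : ℕ} {f g : StrictPartition → K} :
      DegreeLE d f → DegreeLE d g → DegreeLE d fun l => f l + g l
  | mul {d e : ℕ} {f g : StrictPartition → K} :
      DegreeLE d f → DegreeLE e g → DegreeLE (d + e) fun l => f l * g l
  | mono {d e : ℕ} {f : StrictPartition → K} : d ≤ e → DegreeLE d f → DegreeLE e f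

theorem DegreeLE.const_mul {d : ℕ} {f : StrictPartition → K} (h : DegreeLE d f) (c : K) :
    DegreeLE d fun l => c * f l := by
  have := (DegreeLE.const c).mul h
  rwa [zero_add] at this

theorem DegreeLE.sum {ι : Type*} {s : Finset ι} {d : ℕ} {f : ι → StrictPartition → K}
    (h : ∀ i ∈ s, DegreeLE d (f i)) : DegreeLE d fun l => ∑ i ∈ s, f i l := by
  classical
  induction s using Finset.induction_on with
  | empty => simpa using (DegreeLE.const (0 : K)).mono (Nat.zero_le d)
  | insert i s hi ih =>
    simp only [Finset.sum_insert hi]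
    exact (h i (Finset.mem_insert_self _ _)).add
      (ih fun j hj => h j (Finset.mem_insert_of_mem hj))

/-- Functions of a strict partition and of a part `p` to be increased, spanned by the functions
`binom(p + 1, 2) ^ j * f l` with `f` of degree less than `d - j`. -/
inductive IncrementDegreeLT : ℕ → (StrictPartition → ℕ → K) → Prop
  | zero (d : ℕ) : IncrementDegreeLT d fun _ _ => 0
  | add {d : ℕ} {g h : StrictPartition → ℕ → K} : IncrementDegreeLT d g →
      IncrementDegreeLT d h → IncrementDegreeLT d fun l p => g l p + h l p
  | base {d e j : ℕ} {f : StrictPartition → K} : DegreeLE e f → e + j + 1 ≤ d →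
      IncrementDegreeLT d fun l p => ((p + 1).choose 2 : K) ^ j * f l

namespace IncrementDegreeLT

variable {d e : ℕ} {g h : StrictPartition → ℕ → K} {f : StrictPartition → K}

theorem mono (hg : IncrementDegreeLT d g) (hde : d ≤ e) : IncrementDegreeLT e g := by
  induction hg with
  | zero => exact zero _
  | add _ _ ih1 ih2 => exact ih1.add ih2
  | base hf hd => exact base hf (hd.trans hde)

theorem mul_degreeLE (hg : IncrementDegreeLT d g) (hf : DegreeLE e f) :
    IncrementDegreeLT (d + e) fun l p => g l p * f l := by
  induction hg with
  | zero => simpa using zero (K := K) _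
  | add _ _ ih1 ih2 => simpa only [add_mul] using ih1.add ih2
  | base hf' hd => simpa only [mul_assoc] using base (hf'.mul hf) (by omega)

theorem pow_mul (hg : IncrementDegreeLT d g) (j : ℕ) :
    IncrementDegreeLT (d + j) fun l p => ((p + 1).choose 2 : K) ^ j * g l p := by
  induction hg with
  | zero => simpa using zero (K := K) _
  | add _ _ ih1 ih2 => simpa only [mul_add] using ih1.add ih2
  | base hf' hd =>
    simp only [← mul_assoc, ← pow_add]
    exact base hf' (by omega)

theorem mul (hg : IncrementDegreeLT d g) (hh : IncrementDegreeLT e h) :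
    IncrementDegreeLT (d + e) fun l p => g l p * h l p := by
  induction hg with
  | zero => simpa using zero (K := K) _
  | add _ _ ih1 ih2 => simpa only [add_mul] using ih1.add ih2
  | @base e' j f hf' hd =>
    have := (hh.mul_degreeLE hf').pow_mul j
    have h1 : (fun (l : StrictPartition) p => ((p + 1).choose 2 : K) ^ j * f l * h l p)
        = fun l p => ((p + 1).choose 2 : K) ^ j * (h l p * f l) := by
      funext l p
      ring
    rw [h1]
    exact this.mono (by omega)

theorem const_mul (hg : IncrementDegreeLT d g) (c : K) :
    IncrementDegreeLT d fun l p => c * g l p := by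
  have := hg.mul_degreeLE (DegreeLE.const c)
  simpa only [mul_comm _ c, add_zero] using this

theorem pow (j : ℕ) : IncrementDegreeLT (j + 1)
    fun _ p => ((p + 1).choose 2 : K) ^ j := by
  have := base (j := j) (d := j + 1) (DegreeLE.const (1 : K)) (by omega)
  simpa using this

theorem eq_zero (hg : IncrementDegreeLT 0 g) (l : StrictPartition) (p : ℕ) : g l p = 0 := by
  induction hg with
  | zero => rfl
  | add _ _ ih1 ih2 => simp only [ih1, ih2, add_zero]
  | base _ h => omega

end IncrementDegreeLT

section CharZero

variable [CharZero K]

theorem incrementDegreeLT_q (k : ℕ) : IncrementDegreeLT (K := K) k fun _ p =>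
    ((p + 2).choose 2 : K) ^ k + (p.choose 2 : K) ^ k - 2 * ((p + 1).choose 2 : K) ^ k := by
  induction k using Nat.twoStepInduction with
  | zero =>
    have h : ((1 : K) + 1 - 2) = 0 := by norm_num
    simpa [h] using IncrementDegreeLT.zero (K := K) 0
  | one =>
    have h : ∀ p : ℕ, ((p + 2).choose 2 : K) + (p.choose 2 : K) - 2 * ((p + 1).choose 2 : K)
        = 1 := by
      intro p
      rw [Nat.cast_choose_two, Nat.cast_choose_two, Nat.cast_choose_two]
      push_cast
      ring
    simpa [h] using IncrementDegreeLT.pow (K := K) 0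
  | more k ih1 ih2 =>
    have h1 := (ih2.pow_mul 1).const_mul 2
    have h2 := ih2.mono (Nat.le_succ _)
    have h3 := (ih1.pow_mul 2).const_mul (-1)
    have h4 := (ih1.pow_mul 1).mono (Nat.le_succ _)
    have h5 := (IncrementDegreeLT.pow (K := K) (k + 1)).const_mul 4
    have h := (((h1.add h2).add h3).add h4).add h5
    convert h using 3 with l p
    rw [Nat.cast_choose_two, Nat.cast_choose_two, Nat.cast_choose_two]
    push_cast
    ring

theorem DegreeLE.exists_increment {d : ℕ} {f : StrictPartition → K} (hf : DegreeLE d f) :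
    ∃ g, IncrementDegreeLT d g ∧ ∀ l, ∀ p ∈ l.growable, f (l.addBox p) = f l + g l p := by
  induction hf with
  | const c => exact ⟨_, .zero 0, by simp⟩
  | q k => exact ⟨_, incrementDegreeLT_q k, fun l p hp => q_addBox k hp⟩
  | contentPowerSum k => exact ⟨_, .pow k, fun l p hp => contentPowerSum_addBox k hp⟩
  | add _ _ ih1 ih2 =>
    obtain ⟨g1, h1, e1⟩ := ih1
    obtain ⟨g2, h2, e2⟩ := ih2
    refine ⟨_, h1.add h2, fun l p hp => ?_⟩
    simp only [e1 l p hp, e2 l p hp]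
    ring
  | @mul d e f1 f2 hf1 hf2 ih1 ih2 =>
    obtain ⟨g1, h1, e1⟩ := ih1
    obtain ⟨g2, h2, e2⟩ := ih2
    refine ⟨_, ((h1.mul_degreeLE hf2).add
      ((h2.mul_degreeLE hf1).mono (Nat.add_comm _ _).le)).add (h1.mul h2), fun l p hp => ?_⟩
    simp only [e1 l p hp, e2 l p hp]
    ring
  | mono hde _ ih =>
    obtain ⟨g, h, e⟩ := ih
    exact ⟨g, h.mono hde, e⟩

theorem degreeLE_growMoment (k : ℕ) : DegreeLE k (growMoment K k) := by
  induction k using Nat.strong_induction_on with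
  | _ k ih =>
    cases k with
    | zero =>
      have : growMoment K 0 = fun _ => (1 : K) := funext growMoment_zero
      rw [this]
      exact .const 1
    | succ k =>
      have h0 : (k : K) + 1 ≠ 0 := by exact_mod_cast k.succ_ne_zero
      have : growMoment K (k + 1) = fun l => ((k : K) + 1)⁻¹ *
          ∑ x ∈ Finset.HasAntidiagonal.antidiagonal k, growMoment K x.1 l * q K (x.2 + 1) l := by
        funext l
        rw [← succ_mul_growMoment_succ, inv_mul_cancel_left₀ h0]
      rw [this]
      apply DegreeLE.const_mul
      apply DegreeLE.sum
      intro x hx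
      rw [Finset.HasAntidiagonal.mem_antidiagonal] at hx
      exact ((ih x.1 (by omega)).mul (.q (x.2 + 1))).mono (by omega)

theorem IncrementDegreeLT.degreeLE_sum {d : ℕ} {g : StrictPartition → ℕ → K}
    (hg : IncrementDegreeLT d g) :
    DegreeLE (d - 1) fun l => ∑ p ∈ l.growable, growRatio K l p * g l p := by
  induction hg with
  | zero => simpa using (DegreeLE.const (0 : K)).mono (Nat.zero_le _)
  | add _ _ ih1 ih2 => simpa only [mul_add, Finset.sum_add_distrib] using ih1.add ih2
  | @base e j f hf hd =>
    have := ((degreeLE_growMoment (K := K) j).mul hf).mono (e := d - 1) (by omega)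
    simpa only [growMoment, Finset.sum_mul, mul_assoc] using this

/-- The operator `diffOp`, conjugated by the hook products. -/
noncomputable def reducedDiffOp (f : StrictPartition → K) (l : StrictPartition) : K :=
  ∑ p ∈ l.growable, growRatio K l p * (f (l.addBox p) - f l)

theorem diffOp_div_hookProduct (f : StrictPartition → K) :
    (diffOp fun l => f l / (l.hookProduct : K))
      = fun l => reducedDiffOp f l / (l.hookProduct : K) := by
  funext l
  have h1 : ∑ p ∈ l.growable, growRatio K l p = 1 := by
    have := growMoment_zero (K := K) l
    simpa [growMoment] using this
  have hl := hookProduct_ne_zero K l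
  rw [diffOp_apply, reducedDiffOp]
  simp only [mul_sub, Finset.sum_sub_distrib, ← Finset.sum_mul]
  rw [h1, one_mul, sub_div, Finset.sum_div]
  congr 1
  apply Finset.sum_congr rfl
  intro p hp
  have := hookProduct_ne_zero K (l.addBox p)
  rw [growRatio_eq K hp]
  field_simp

theorem DegreeLE.reducedDiffOp {d : ℕ} {f : StrictPartition → K} (hf : DegreeLE d f) :
    DegreeLE (d - 1) (reducedDiffOp f) ∧ (d = 0 → StrictPartition.reducedDiffOp f = 0) := by
  obtain ⟨g, hg, hfg⟩ := hf.exists_increment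
  have h : StrictPartition.reducedDiffOp f
      = fun l => ∑ p ∈ l.growable, growRatio K l p * g l p := by
    funext l
    apply Finset.sum_congr rfl
    intro p hp
    rw [hfg l p hp, add_sub_cancel_left]
  rw [h]
  refine ⟨hg.degreeLE_sum, ?_⟩
  rintro rfl
  funext l
  simp [hg.eq_zero]

theorem DegreeLE.iterate_diffOp_eq_zero {d : ℕ} {f : StrictPartition → K} (hf : DegreeLE d f) :
    diffOp^[d + 1] (fun l => f l / (l.hookProduct : K)) = 0 := by
  induction d generalizing f with
  | zero =>
    rw [Function.iterate_one, diffOp_div_hookProduct, hf.reducedDiffOp.2 rfl]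
    funext l
    simp
  | succ d ih =>
    rw [Function.iterate_succ_apply, diffOp_div_hookProduct]
    exact ih hf.reducedDiffOp.1

end CharZero

end StrictPartition

section PowerSums

variable {K : Type*} [Field K]

/-- The sum of the monomials `∏ j, x (i j) ^ k j` over all injections `i`: the augmented monomial
symmetric polynomial with exponents `k`. -/
noncomputable def augmentedMonomial {n r : ℕ} (x : Fin n → K) (k : Fin r → ℕ) : K :=
  ∑ i : Fin r ↪ Fin n, ∏ j, x (i j) ^ k j

theorem sum_pow_mul_augmentedMonomial {n r : ℕ} (x : Fin n → K) (k : Fin r → ℕ) (a : ℕ) :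
    (∑ t, x t ^ a) * augmentedMonomial x k
      = augmentedMonomial x (Fin.cons a k : Fin (r + 1) → ℕ)
        + ∑ j, augmentedMonomial x (Function.update k j (k j + a)) := by
  have h1 : augmentedMonomial x (Fin.cons a k : Fin (r + 1) → ℕ)
      = ∑ i : Fin r ↪ Fin n, ∑ t with t ∉ Set.range i, x t ^ a * ∏ j, x (i j) ^ k j := by
    rw [augmentedMonomial, ← (Equiv.embeddingFinSucc r (Fin n)).symm.sum_comp,
      Fintype.sum_sigma]
    apply Finset.sum_congr rfl
    intro i _
    rw [Finset.sum_subtype (p := fun t => t ∉ Set.range i) _ (by simp)]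
    apply Finset.sum_congr rfl
    intro t _
    simp [Fin.prod_univ_succ]
  have h2 : ∑ j, augmentedMonomial x (Function.update k j (k j + a))
      = ∑ i : Fin r ↪ Fin n, ∑ t with t ∈ Set.range i, x t ^ a * ∏ j, x (i j) ^ k j := by
    simp only [augmentedMonomial]
    rw [Finset.sum_comm]
    apply Finset.sum_congr rfl
    intro i _
    have : (Finset.univ.filter fun t => t ∈ Set.range i) = Finset.univ.map i := by
      ext
      simp
    rw [this, Finset.sum_map]
    apply Finset.sum_congr rfl
    intro j _
    rw [← Finset.mul_prod_erase _ _ (Finset.mem_univ j),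
      ← Finset.mul_prod_erase _ (fun j => x (i j) ^ k j) (Finset.mem_univ j),
      Function.update_self, pow_add, ← mul_assoc, mul_comm (x (i j) ^ a)]
    congr 1
    apply Finset.prod_congr rfl
    intro j' hj'
    rw [Function.update_of_ne (Finset.ne_of_mem_erase hj')]
  rw [h1, h2, ← Finset.sum_add_distrib, augmentedMonomial, Finset.mul_sum]
  apply Finset.sum_congr rfl
  intro i _
  rw [Finset.sum_mul, add_comm, Finset.sum_filter_add_sum_filter_not]

theorem card_embedding_map_eq {α : Type*} [Fintype α] [DecidableEq α] {r : ℕ}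
    (e : Fin r ↪ α) :
    (Finset.univ.filter fun i : Fin r ↪ α => Finset.univ.map i = Finset.univ.map e).card
      = r.factorial := by
  have : (Finset.univ : Finset (Equiv.Perm (Fin r))).card = r.factorial := by
    rw [Finset.card_univ, Fintype.card_perm, Fintype.card_fin]
  rw [← this]
  symm
  apply Finset.card_bij fun σ _ => σ.toEmbedding.trans e
  · intro σ _
    rw [Finset.mem_filter, ← Finset.map_map]
    simp
  · intro σ _ τ _ h
    ext1 j
    exact e.injective (DFunLike.congr_fun h j)
  · intro i hi
    have hi := (Finset.mem_filter.1 hi).2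
    have h : ∀ j, ∃ j', e j' = i j := by
      intro j
      have : i j ∈ Finset.univ.map e := hi ▸ Finset.mem_map_of_mem i (Finset.mem_univ j)
      simpa using this
    choose f hf using h
    have hinj : Function.Injective f := fun a b hab => i.injective (by rw [← hf, ← hf, hab])
    refine ⟨Equiv.ofBijective f (Finite.injective_iff_bijective.1 hinj), Finset.mem_univ _, ?_⟩
    ext1 j
    exact hf j

namespace SymmetricFunction

/-- The coefficient of the monomials whose nonzero exponents are the values of `k`. -/
noncomputable def monomialCoeff (Q : SymmetricFunction K) {r : ℕ} (k : Fin r → ℕ) : K :=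
  MvPowerSeries.coeff (Finsupp.embDomain Fin.valEmbedding (Finsupp.equivFunOnFinite.symm k))
    Q.series

theorem coeff_embDomain (Q : SymmetricFunction K) {r : ℕ} (k : Fin r → ℕ) (e : Fin r ↪ ℕ) :
    MvPowerSeries.coeff (Finsupp.embDomain e (Finsupp.equivFunOnFinite.symm k)) Q.series
      = Q.monomialCoeff k := by
  obtain ⟨σ, hσ⟩ := Equiv.Perm.exists_extending_pair _ _
    (Fin.valEmbedding (n := r)).injective e.injective
  rw [monomialCoeff, ← Q.symmetric σ (Finsupp.embDomain Fin.valEmbedding _),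
    Finsupp.embDomain_eq_mapDomain, Finsupp.embDomain_eq_mapDomain, ← Finsupp.mapDomain_comp]
  congr 3
  funext j
  exact (hσ j).symm

theorem sum_filter_support_eq (Q : SymmetricFunction K) (L : List K) (B : ℕ) {r : ℕ}
    (i : Fin r ↪ Fin L.length) :
    ∑ d ∈ ((Finset.range L.length).finsupp fun _ => Finset.range (B + 1)) with
        d.support = Finset.univ.map (i.trans Fin.valEmbedding),
      MvPowerSeries.coeff d Q.series * d.prod (fun i e => L.getD i 0 ^ e)
      = ∑ k ∈ Fintype.piFinset fun _ : Fin r => Finset.Icc 1 B,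
        Q.monomialCoeff k * ∏ j, L.get (i j) ^ k j := by
  have hsupp : ∀ k ∈ Fintype.piFinset fun _ : Fin r => Finset.Icc 1 B,
      (Finsupp.embDomain (i.trans Fin.valEmbedding) (Finsupp.equivFunOnFinite.symm k)).support
        = Finset.univ.map (i.trans Fin.valEmbedding) := by
    intro k hk
    rw [Finsupp.support_embDomain]
    congr 1
    ext j
    have := (Finset.mem_Icc.1 (Fintype.mem_piFinset.1 hk j)).1
    simp
    omega
  symm
  refine Finset.sum_bij'
    (fun k _ => Finsupp.embDomain (i.trans Fin.valEmbedding) (Finsupp.equivFunOnFinite.symm k))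
    (fun d _ j => d (i j)) ?_ ?_ ?_ ?_ ?_
  · intro k hk
    rw [Finset.mem_filter, Finset.mem_finsupp_iff]
    refine ⟨⟨?_, ?_⟩, hsupp k hk⟩
    · rw [hsupp k hk]
      intro t ht
      obtain ⟨j, _, rfl⟩ := Finset.mem_map.1 ht
      simp
    · intro t _
      by_cases ht : t ∈ Set.range (i.trans Fin.valEmbedding)
      · obtain ⟨j, rfl⟩ := ht
        rw [Finsupp.embDomain_apply_self]
        have := (Finset.mem_Icc.1 (Fintype.mem_piFinset.1 hk j)).2
        simp
        omega
      · rw [Finsupp.embDomain_of_notMem_range _ _ _ ht]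
        simp
  · intro d hd
    rw [Finset.mem_filter, Finset.mem_finsupp_iff] at hd
    rw [Fintype.mem_piFinset]
    intro j
    have h1 : ((i j : ℕ)) ∈ d.support := by
      rw [hd.2]
      exact Finset.mem_map_of_mem (i.trans Fin.valEmbedding) (Finset.mem_univ j)
    have h2 := hd.1.2 (i j) (Finset.mem_range.2 (i j).2)
    rw [Finsupp.mem_support_iff] at h1
    rw [Finset.mem_range] at h2
    rw [Finset.mem_Icc]
    omega
  · intro k _
    funext j
    exact Finsupp.embDomain_apply_self (i.trans Fin.valEmbedding) _ j
  · intro d hd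
    have hd := (Finset.mem_filter.1 hd).2
    ext t
    by_cases ht : t ∈ Set.range (i.trans Fin.valEmbedding)
    · obtain ⟨j, rfl⟩ := ht
      rw [Finsupp.embDomain_apply_self]
      rfl
    · rw [Finsupp.embDomain_of_notMem_range _ _ _ ht]
      symm
      rw [← Finsupp.notMem_support_iff, hd]
      simpa using ht
  · intro k _
    rw [Q.coeff_embDomain, Finsupp.prod_embDomain,
      Finsupp.prod_fintype _ _ fun _ => pow_zero _]
    congr 1
    apply Finset.prod_congr rfl
    intro j _
    simp

theorem exists_eval_eq_sum_augmentedMonomial [CharZero K] (Q : SymmetricFunction K) :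
    ∃ B : ℕ, ∀ s : Multiset K, Q.eval s = ∑ r ∈ Finset.range (B + 1), (r.factorial : K)⁻¹ *
      ∑ k ∈ Fintype.piFinset fun _ : Fin r => Finset.Icc 1 B,
        Q.monomialCoeff k * augmentedMonomial s.toList.get k := by
  obtain ⟨B, hB⟩ := Q.bounded
  refine ⟨B, fun s => ?_⟩
  set L := s.toList
  set G : (ℕ →₀ ℕ) → K := fun d =>
    MvPowerSeries.coeff d Q.series * d.prod (fun i e => L.getD i 0 ^ e) with hG
  set D := (Finset.range L.length).finsupp fun _ => Finset.range (B + 1) with hD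
  have hdeg : ∀ d : ℕ →₀ ℕ, B < d.degree → G d = 0 := by
    intro d hd
    rw [hG]
    simp only [hB d hd, zero_mul]
  have h1 : Q.eval s = ∑ d ∈ D, G d := by
    apply finsum_eq_sum_of_support_subset
    intro d hd
    rw [Finset.mem_coe, hD, Finset.mem_finsupp_iff]
    have hd : G d ≠ 0 := hd
    constructor
    · intro t ht
      rw [Finset.mem_range]
      by_contra! h
      apply hd
      simp only [hG]
      rw [Finsupp.prod, Finset.prod_eq_zero ht, mul_zero]
      rw [List.getD_eq_default _ _ h, zero_pow (Finsupp.mem_support_iff.1 ht)]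
    · intro t _
      rw [Finset.mem_range]
      by_contra! h
      exact hd (hdeg d (lt_of_lt_of_le (by omega) (Finsupp.le_degree t d)))
  have h2 : ∑ d ∈ D, G d
      = ∑ r ∈ Finset.range (B + 1), ∑ d ∈ D with d.support.card = r, G d := by
    rw [Finset.sum_fiberwise_eq_sum_filter, Finset.sum_filter_of_ne]
    intro d _ hd
    rw [Finset.mem_range]
    by_contra! h
    refine hd (hdeg d (lt_of_lt_of_le (by omega) (h.trans ?_)))
    rw [Finsupp.degree_apply, Finset.card_eq_sum_ones]
    exact Finset.sum_le_sum fun t ht => Nat.one_le_iff_ne_zero.2 (Finsupp.mem_support_iff.1 ht)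
  rw [h1, h2]
  apply Finset.sum_congr rfl
  intro r _
  have hfac : (r.factorial : K) ≠ 0 := by exact_mod_cast r.factorial_ne_zero
  rw [eq_inv_mul_iff_mul_eq₀ hfac]
  have h3 : ∑ k ∈ Fintype.piFinset fun _ : Fin r => Finset.Icc 1 B,
        Q.monomialCoeff k * augmentedMonomial L.get k
      = ∑ i : Fin r ↪ Fin L.length, ∑ d ∈ D with
        d.support = Finset.univ.map (i.trans Fin.valEmbedding), G d := by
    simp only [augmentedMonomial, Finset.mul_sum]
    rw [Finset.sum_comm]
    exact Finset.sum_congr rfl fun i _ => (Q.sum_filter_support_eq L B i).symm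
  rw [h3, Finset.mul_sum]
  simp only [Finset.sum_filter]
  rw [Finset.sum_comm]
  apply Finset.sum_congr rfl
  intro d hd
  rw [hD, Finset.mem_finsupp_iff] at hd
  split_ifs with h
  · rw [← Finset.sum_filter, Finset.sum_const, nsmul_eq_mul]
    congr 2
    set e : Fin r ↪ Fin L.length :=
      ⟨fun j => ⟨d.support.orderEmbOfFin h j,
        Finset.mem_range.1 (hd.1 (Finset.orderEmbOfFin_mem _ h j))⟩, fun a b hab => by
        simpa using hab⟩ with he
    rw [← card_embedding_map_eq e]
    congr 1
    apply Finset.filter_congr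
    intro i _
    have hde : d.support = Finset.univ.map (e.trans Fin.valEmbedding) := by
      rw [← Finset.map_orderEmbOfFin_univ d.support h]
      rfl
    rw [hde, ← Finset.map_map, ← Finset.map_map, Finset.map_inj]
    exact eq_comm
  · symm
    apply Finset.sum_eq_zero
    intro i _
    rw [if_neg]
    intro hi
    apply h
    rw [hi]
    simp

end SymmetricFunction

end PowerSums

namespace StrictPartition

variable {K : Type*} [Field K]

theorem exists_degreeLE_augmentedMonomial {n : StrictPartition → ℕ}
    {x : ∀ l, Fin (n l) → K} (hx : ∀ a l, ∑ t, x l t ^ a = contentPowerSum K a l) {r : ℕ}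
    (k : Fin r → ℕ) : ∃ d, DegreeLE d fun l => augmentedMonomial (x l) k := by
  induction r with
  | zero =>
    refine ⟨0, ?_⟩
    simpa [augmentedMonomial] using DegreeLE.const (1 : K)
  | succ r ih =>
    have h : (fun l => augmentedMonomial (x l) k)
        = fun l => contentPowerSum K (k 0) l * augmentedMonomial (x l) (Fin.tail k)
          + (-1) * ∑ j, augmentedMonomial (x l)
            (Function.update (Fin.tail k) j (Fin.tail k j + k 0)) := by
      funext l
      rw [← hx, sum_pow_mul_augmentedMonomial, Fin.cons_self_tail]
      ring
    obtain ⟨d, hd⟩ := ih (Fin.tail k)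
    choose e he using fun j => ih (Function.update (Fin.tail k) j (Fin.tail k j + k 0))
    rw [h]
    refine ⟨(k 0 + 1 + d) + ∑ j, e j,
      (((DegreeLE.contentPowerSum (k 0)).mul hd).mono (Nat.le_add_right _ _)).add
        ((DegreeLE.const_mul (DegreeLE.sum fun j _ => (he j).mono ?_) _))⟩
    exact (Finset.single_le_sum (fun _ _ => Nat.zero_le _) (Finset.mem_univ j)).trans
      (Nat.le_add_left _ _)

theorem exists_degreeLE_sum {ι : Type*} {s : Finset ι} {f : ι → StrictPartition → K}
    (h : ∀ i, ∃ d, DegreeLE d (f i)) : ∃ d, DegreeLE d fun l => ∑ i ∈ s, f i l := by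
  choose d hd using h
  exact ⟨∑ i ∈ s, d i, DegreeLE.sum fun i hi =>
    (hd i).mono (Finset.single_le_sum (fun _ _ => Nat.zero_le _) hi)⟩

theorem exists_degreeLE_eval [CharZero K] (Q : SymmetricFunction K) :
    ∃ d, DegreeLE d fun l => Q.eval (l.contentValues K) := by
  obtain ⟨B, hB⟩ := Q.exists_eval_eq_sum_augmentedMonomial
  have hx : ∀ a (l : StrictPartition),
      ∑ t, (l.contentValues K).toList.get t ^ a = contentPowerSum K a l := by
    intro a l
    have h : ∑ t, (l.contentValues K).toList.get t ^ a
        = (List.ofFn ((· ^ a) ∘ (l.contentValues K).toList.get)).sum := List.sum_ofFn.symm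
    rw [h, ← List.map_ofFn, List.ofFn_get, ← Multiset.sum_coe, ← Multiset.map_coe,
      Multiset.coe_toList, contentValues, Multiset.map_map]
    rfl
  simp only [hB]
  refine exists_degreeLE_sum fun r => ?_
  obtain ⟨d, hd⟩ := exists_degreeLE_sum (s := Fintype.piFinset fun _ : Fin r => Finset.Icc 1 B)
    (f := fun k l => Q.monomialCoeff k * augmentedMonomial (l.contentValues K).toList.get k)
    fun k => by
      obtain ⟨d, hd⟩ := exists_degreeLE_augmentedMonomial hx k
      exact ⟨d, hd.const_mul _⟩
  exact ⟨d, hd.const_mul _⟩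

theorem exists_degreeLE_qPartition {N : ℕ} (ν : Nat.Partition N) :
    ∃ d, DegreeLE d fun l => qPartition K ν l := by
  simp only [qPartition]
  induction ν.parts using Multiset.induction_on with
  | empty => exact ⟨0, by simpa using DegreeLE.const (1 : K)⟩
  | cons k s ih =>
    obtain ⟨d, hd⟩ := ih
    simp only [Multiset.map_cons, Multiset.prod_cons]
    exact ⟨_, (DegreeLE.q k).mul hd⟩

theorem exists_degreeLE_eval_mul_qPartition [CharZero K] {N : ℕ} (ν : Nat.Partition N)
    (Q : SymmetricFunction K) :
    ∃ d, DegreeLE d fun l => Q.eval (l.contentValues K) * l.qPartition K ν := by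
  obtain ⟨d, hd⟩ := exists_degreeLE_eval Q
  obtain ⟨e, he⟩ := exists_degreeLE_qPartition (K := K) ν
  exact ⟨_, hd.mul he⟩

end StrictPartition

namespace StrictPartition

/-- A bijective filling of a finite set of boxes by `Fin n` that increases along rows and
columns. -/
def IsStandardFilling {s : Finset (ℕ × ℕ)} {n : ℕ} (T : {b // b ∈ s} ≃ Fin n) : Prop :=
  (∀ a b : {b // b ∈ s}, a.1.1 = b.1.1 → a.1.2 < b.1.2 → T a < T b) ∧
  (∀ a b : {b // b ∈ s}, a.1.2 = b.1.2 → a.1.1 < b.1.1 → T a < T b)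

/-- The number of standard fillings of a finite set of boxes by `Fin n`. -/
noncomputable def numFillings (s : Finset (ℕ × ℕ)) (n : ℕ) : ℕ :=
  Nat.card {T : {b // b ∈ s} ≃ Fin n // IsStandardFilling T}

theorem numTableaux_eq_numFillings {l m : StrictPartition} {n : ℕ}
    (h : (skewDiagram l m).card = n) : l.numTableaux m = numFillings (skewDiagram l m) n := by
  subst h
  rfl

/-- A box of `s` with no box of `s` to its left in its row or above it in its column. -/
def IsMinimalBox (s : Finset (ℕ × ℕ)) (b : ℕ × ℕ) : Prop :=
  ∀ a ∈ s, ¬(a.1 = b.1 ∧ a.2 < b.2) ∧ ¬(a.2 = b.2 ∧ a.1 < b.1)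

/-- Remove the box with the smallest entry from a filling. -/
def fillingErase {s : Finset (ℕ × ℕ)} {n : ℕ} {b : {b // b ∈ s}}
    (T : {b // b ∈ s} ≃ Fin (n + 1)) (hT : T.symm 0 = b) : {x // x ∈ s.erase b.1} ≃ Fin n where
  toFun x := (T ⟨x.1, Finset.mem_of_mem_erase x.2⟩).pred fun h =>
    Finset.ne_of_mem_erase x.2
      (congrArg Subtype.val ((T.symm_apply_eq.2 h.symm).symm.trans hT))
  invFun i := ⟨(T.symm i.succ).1, Finset.mem_erase.2 ⟨fun h =>
    i.succ_ne_zero (T.symm.injective (Subtype.ext (h.trans (congrArg Subtype.val hT).symm))),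
    (T.symm i.succ).2⟩⟩
  left_inv x := by simp
  right_inv i := by simp

/-- Insert a box with a new smallest entry into a filling. -/
def fillingInsert {s : Finset (ℕ × ℕ)} {n : ℕ} (b : {b // b ∈ s})
    (T : {x // x ∈ s.erase b.1} ≃ Fin n) : {b // b ∈ s} ≃ Fin (n + 1) where
  toFun x := if h : x = b then 0 else
    (T ⟨x.1, Finset.mem_erase.2 ⟨fun h' => h (Subtype.ext h'), x.2⟩⟩).succ
  invFun i := Fin.cases b (fun i => ⟨(T.symm i).1, Finset.mem_of_mem_erase (T.symm i).2⟩) i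
  left_inv x := by
    by_cases h : x = b
    · simp [h]
    · simp [h]
  right_inv i := by
    cases i using Fin.cases with
    | zero => simp
    | succ i =>
      have h : ¬ (⟨(T.symm i).1, Finset.mem_of_mem_erase (T.symm i).2⟩ : {b // b ∈ s}) = b :=
        fun h => Finset.ne_of_mem_erase (T.symm i).2 (congrArg Subtype.val h)
      simp [h]

theorem card_fiber_eq_numFillings {s : Finset (ℕ × ℕ)} {n : ℕ} {b : {b // b ∈ s}}
    (hb : IsMinimalBox s b.1) :
    Nat.card {T : {T : {b // b ∈ s} ≃ Fin (n + 1) // IsStandardFilling T} // T.1.symm 0 = b}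
      = numFillings (s.erase b.1) n := by
  have hins : ∀ (T : {x // x ∈ s.erase b.1} ≃ Fin n) (x y : {b // b ∈ s}), y ≠ b →
      (∀ (hx : x.1 ∈ s.erase b.1) (hy : y.1 ∈ s.erase b.1), T ⟨x.1, hx⟩ < T ⟨y.1, hy⟩) →
      fillingInsert b T x < fillingInsert b T y := by
    intro T x y hy h
    have hy' : y.1 ∈ s.erase b.1 := Finset.mem_erase.2 ⟨fun h => hy (Subtype.ext h), y.2⟩
    by_cases hx : x = b
    · simp [fillingInsert, hx, hy]
    · simpa [fillingInsert, hx, hy] using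
        h (Finset.mem_erase.2 ⟨fun h => hx (Subtype.ext h), x.2⟩) hy'
  refine Nat.card_congr
    { toFun := fun T => ⟨fillingErase T.1.1 T.2, ?_, ?_⟩
      invFun := fun T => ⟨⟨fillingInsert b T.1, ?_, ?_⟩, by simp [fillingInsert]⟩
      left_inv := ?_
      right_inv := ?_ }
  · intro x y h h'
    have := T.1.2.1 ⟨x.1, Finset.mem_of_mem_erase x.2⟩ ⟨y.1, Finset.mem_of_mem_erase y.2⟩ h h'
    simpa only [fillingErase, Equiv.coe_fn_mk, Fin.pred_lt_pred_iff] using this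
  · intro x y h h'
    have := T.1.2.2 ⟨x.1, Finset.mem_of_mem_erase x.2⟩ ⟨y.1, Finset.mem_of_mem_erase y.2⟩ h h'
    simpa only [fillingErase, Equiv.coe_fn_mk, Fin.pred_lt_pred_iff] using this
  · intro x y h h'
    exact hins T.1 x y (fun hy => (hb x.1 x.2).1 (hy ▸ ⟨h, h'⟩))
      fun hx hy => T.2.1 ⟨x.1, hx⟩ ⟨y.1, hy⟩ h h'
  · intro x y h h'
    exact hins T.1 x y (fun hy => (hb x.1 x.2).2 (hy ▸ ⟨h, h'⟩))
      fun hx hy => T.2.2 ⟨x.1, hx⟩ ⟨y.1, hy⟩ h h'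
  · rintro ⟨⟨T, hT⟩, hTb⟩
    apply Subtype.ext
    apply Subtype.ext
    ext1 x
    by_cases hx : x = b
    · subst hx
      simp [fillingInsert, ← hTb]
    · simp [fillingInsert, fillingErase, hx]
  · rintro ⟨T, hT⟩
    apply Subtype.ext
    ext1 x
    have h : ¬ (⟨x.1, Finset.mem_of_mem_erase x.2⟩ : {b // b ∈ s}) = b :=
      fun h => Finset.ne_of_mem_erase x.2 (congrArg Subtype.val h)
    simp [fillingInsert, fillingErase, h]

open Classical in
theorem numFillings_succ (s : Finset (ℕ × ℕ)) (n : ℕ) :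
    numFillings s (n + 1)
      = ∑ b ∈ s with IsMinimalBox s b, numFillings (s.erase b) n := by
  rw [numFillings, ← Nat.card_congr (Equiv.sigmaFiberEquiv
    fun T : {T : {b // b ∈ s} ≃ Fin (n + 1) // IsStandardFilling T} => T.1.symm 0),
    Nat.card_sigma, Finset.sum_filter, ← Finset.sum_coe_sort s]
  apply Finset.sum_congr rfl
  intro b _
  split_ifs with hb
  · exact card_fiber_eq_numFillings hb
  · rw [Nat.card_eq_zero]
    left
    refine ⟨fun ⟨⟨T, hT⟩, hTb⟩ => hb fun a ha => ⟨fun h => ?_, fun h => ?_⟩⟩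
    · have := hT.1 ⟨a, ha⟩ b h.1 h.2
      simp [← hTb] at this
    · have := hT.2 ⟨a, ha⟩ b h.1 h.2
      simp [← hTb] at this

theorem contained_addBox_iff {m l : StrictPartition} {p : ℕ} (hp : p ∈ m.growable)
    (hml : m.Contained l) : (m.addBox p).Contained l ↔ m.newBox p ∈ l.diagram := by
  rw [contained_iff_diagram_subset] at hml ⊢
  rw [diagram_addBox hp, Finset.insert_subset_iff]
  exact and_iff_left hml

theorem isMinimalBox_skewDiagram_iff {m l : StrictPartition} (hml : m.Contained l) {b : ℕ × ℕ} :
    (b ∈ skewDiagram l m ∧ IsMinimalBox (skewDiagram l m) b)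
      ↔ ∃ p ∈ m.growable, (m.addBox p).Contained l ∧ m.newBox p = b := by
  constructor
  · rintro ⟨hb, hmin⟩
    obtain ⟨i, j⟩ := b
    rw [skewDiagram, Finset.mem_sdiff, mem_diagram, mem_diagram] at hb
    simp only [not_and, not_le] at hb
    obtain ⟨⟨hi, hij, hl⟩, hm⟩ := hb
    obtain ⟨t, rfl⟩ : ∃ t, j = i + (t + 1) := ⟨j - i - 1, by omega⟩
    rw [Nat.add_sub_cancel_left] at hl hm
    have hm := hm hi hij
    have habove : i - 1 ≤ m.countGE (t + 2) := by
      by_contra! h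
      refine (hmin (i - 1, i + (t + 1)) ?_).2 ⟨rfl, by simp only; omega⟩
      have h1 : i + (t + 1) - (i - 1) = t + 2 := by omega
      rw [skewDiagram, Finset.mem_sdiff, mem_diagram, mem_diagram]
      simp only [h1]
      have := l.countGE_add_le (t + 1) 1
      refine ⟨⟨by omega, by omega, ?_⟩, by omega⟩
      change l.countGE (t + 1) ≤ l.countGE (t + 2) + 1 at this
      omega
    have h2 := m.countGE_eq_succ (t + 1)
    change m.countGE (t + 1) = m.countGE (t + 2) + _ at h2
    have hleft : t = 0 ∨ i ≤ m.countGE t := by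
      by_contra! h
      refine (hmin (i, i + t) ?_).1 ⟨rfl, by simp only; omega⟩
      rw [skewDiagram, Finset.mem_sdiff, mem_diagram, mem_diagram]
      simp only [Nat.add_sub_cancel_left]
      have := l.countGE_antitone (Nat.le_succ t)
      refine ⟨⟨hi, by omega, hl.trans this⟩, by omega⟩
    have h3 := m.countGE_eq_succ t
    have hgrow : t ∈ m.growable := by
      rw [mem_growable]
      constructor
      · by_contra! h
        rw [if_neg h.2] at h3
        rcases hleft with h | h <;> omega
      · intro h
        rw [if_pos h] at h2
        omega
    have hbox : m.newBox t = (i, i + (t + 1)) := by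
      have : m.countGE (t + 1) + 1 = i := by
        rw [if_neg (mem_growable.1 hgrow).2] at h2
        omega
      rw [newBox, this]
    refine ⟨t, hgrow, ?_, hbox⟩
    rw [contained_addBox_iff hgrow hml, hbox, mem_diagram, Nat.add_sub_cancel_left]
    exact ⟨hi, hij, hl⟩
  · rintro ⟨p, hp, hc, rfl⟩
    rw [contained_addBox_iff hp hml] at hc
    refine ⟨Finset.mem_sdiff.2 ⟨hc, m.newBox_notMem p⟩, ?_⟩
    rintro ⟨i, j⟩ ha
    rw [skewDiagram, Finset.mem_sdiff, mem_diagram, mem_diagram] at ha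
    simp only [not_and, not_le] at ha
    have hm := ha.2 ha.1.1 ha.1.2.1
    simp only [newBox]
    constructor
    · rintro ⟨rfl, h⟩
      have := m.countGE_eq_succ p
      have h1 := mem_growable.1 hp
      have h2 := m.countGE_antitone
        (show j - (m.countGE (p + 1) + 1) ≤ p by have := ha.1.2.1; omega)
      rcases h1.1 with rfl | h3
      · have := ha.1.2.1
        omega
      · rw [if_pos h3] at this
        omega
    · rintro ⟨rfl, h⟩
      obtain ⟨d, hd⟩ : ∃ d, m.countGE (p + 1) + 1 = i + (d + 1) :=
        ⟨m.countGE (p + 1) - i, by omega⟩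
      have h1 : m.countGE (p + 1) + 1 + (p + 1) - i = p + 2 + d := by omega
      rw [h1] at hm
      have h2 := m.countGE_add_le (p + 2) d
      rw [countGE_of_mem_growable hp] at h2
      omega

open Classical in
theorem numTableaux_eq_sum {m l : StrictPartition} {n : ℕ} (hl : l ∈ m.above (n + 1)) :
    l.numTableaux m
      = ∑ p ∈ m.growable with (m.addBox p).Contained l, l.numTableaux (m.addBox p) := by
  rw [mem_above] at hl
  have hcard : (skewDiagram l m).card = n + 1 := by
    rw [skewDiagram, Finset.card_sdiff_of_subset (contained_iff_diagram_subset.1 hl.2),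
      card_diagram, card_diagram]
    omega
  have herase : ∀ p ∈ m.growable,
      skewDiagram l (m.addBox p) = (skewDiagram l m).erase (m.newBox p) := by
    intro p hp
    rw [skewDiagram, diagram_addBox hp, Finset.sdiff_insert, skewDiagram]
  have hinj : Set.InjOn m.newBox m.growable := by
    intro p hp r hr h
    rw [newBox, newBox, Prod.mk.injEq] at h
    omega
  have himage : ((skewDiagram l m).filter fun b => IsMinimalBox (skewDiagram l m) b)
      = (m.growable.filter fun p => (m.addBox p).Contained l).image m.newBox := by
    ext b
    rw [Finset.mem_filter, isMinimalBox_skewDiagram_iff hl.2]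
    simp [and_assoc]
  rw [numTableaux_eq_numFillings hcard, numFillings_succ, himage,
    Finset.sum_image (hinj.mono (Finset.coe_subset.2 (Finset.filter_subset _ _)))]
  apply Finset.sum_congr rfl
  intro p hp
  have hp' := Finset.mem_filter.1 hp
  rw [numTableaux_eq_numFillings (n := n), herase p hp'.1]
  rw [herase p hp'.1, Finset.card_erase_of_mem, hcard, Nat.add_sub_cancel]
  exact ((isMinimalBox_skewDiagram_iff hl.2).2 ⟨p, hp'.1, hp'.2, rfl⟩).1

theorem above_zero (m : StrictPartition) : m.above 0 = {m} := by
  ext l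
  rw [mem_above, Finset.mem_singleton]
  constructor
  · rintro ⟨hs, hc⟩
    rw [contained_iff_diagram_subset] at hc
    have hd : m.diagram = l.diagram :=
      Finset.eq_of_subset_of_card_le hc (by rw [card_diagram, card_diagram]; omega)
    apply eq_of_countGE_eq
    intro t ht
    exact le_antisymm (contained_iff_countGE.1 (contained_iff_diagram_subset.2 hd.ge) t ht)
      (contained_iff_countGE.1 (contained_iff_diagram_subset.2 hd.le) t ht)
  · rintro rfl
    exact ⟨rfl, Contained.refl _⟩

theorem numTableaux_self (m : StrictPartition) : m.numTableaux m = 1 := by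
  have h : skewDiagram m m = ∅ := Finset.sdiff_self _
  rw [numTableaux_eq_numFillings (n := 0) (by rw [h, Finset.card_empty]), h, numFillings,
    Nat.card_eq_one_iff_unique]
  constructor
  · exact ⟨fun a b => Subtype.ext (Equiv.ext fun x => absurd x.2 (Finset.notMem_empty _))⟩
  · exact ⟨⟨Equiv.equivOfIsEmpty _ _, fun x => absurd x.2 (Finset.notMem_empty _),
      fun x => absurd x.2 (Finset.notMem_empty _)⟩⟩

section

variable {K : Type*} [Field K]

/-- The operator `diffOp` as a linear map. -/
noncomputable def diffLinear (K : Type*) [Field K] : Module.End K (StrictPartition → K) where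
  toFun := diffOp
  map_add' f g := by
    funext l
    simp only [Pi.add_apply, diffOp_apply, mul_add, Finset.sum_add_distrib]
    ring
  map_smul' c f := by
    funext l
    simp only [Pi.smul_apply, smul_eq_mul, diffOp_apply, mul_left_comm _ c, ← Finset.mul_sum,
      RingHom.id_apply]
    ring

theorem diffLinear_pow_apply (r : ℕ) (g : StrictPartition → K) :
    (diffLinear K ^ r) g = diffOp^[r] g := by
  rw [Module.End.pow_apply]
  rfl

theorem one_add_diffLinear_apply (g : StrictPartition → K) (l : StrictPartition) :
    (1 + diffLinear K) g l = ∑ p ∈ l.growable, (growWeight p : K) * g (l.addBox p) := by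
  change g l + diffOp g l = _
  rw [diffOp_apply]
  ring

theorem one_add_diffLinear_pow_apply [CharZero K] (g : StrictPartition → K) (n : ℕ)
    (m : StrictPartition) :
    ((1 + diffLinear K) ^ n) g m = ∑ l ∈ m.above n,
      (2 : K) ^ ((l.size : ℤ) - m.size - l.length + m.length) * (l.numTableaux m : K) * g l := by
  classical
  induction n generalizing m with
  | zero =>
    rw [above_zero, Finset.sum_singleton, numTableaux_self]
    simp
  | succ n ih =>
    rw [pow_succ', Module.End.mul_apply, one_add_diffLinear_apply]
    have h : ∀ l ∈ m.above (n + 1),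
        (2 : K) ^ ((l.size : ℤ) - m.size - l.length + m.length) * (l.numTableaux m : K) * g l
        = ∑ p ∈ m.growable with (m.addBox p).Contained l, (growWeight p : K)
          * ((2 : K) ^ ((l.size : ℤ) - (m.addBox p).size - l.length + (m.addBox p).length)
            * (l.numTableaux (m.addBox p) : K) * g l) := by
      intro l hl
      rw [numTableaux_eq_sum hl, Nat.cast_sum, Finset.mul_sum, Finset.sum_mul]
      apply Finset.sum_congr rfl
      intro p hp
      have hp := (Finset.mem_filter.1 hp).1
      have hw : (2 : K) ^ ((l.size : ℤ) - m.size - l.length + m.length) = (growWeight p : K)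
          * (2 : K) ^ ((l.size : ℤ) - (m.addBox p).size - l.length + (m.addBox p).length) := by
        rw [size_addBox hp, length_addBox hp, growWeight]
        split_ifs
        · rw [Nat.cast_one, one_mul]
          congr 1
          push_cast
          ring
        · rw [Nat.cast_ofNat, ← zpow_one_add₀ two_ne_zero]
          congr 1
          push_cast
          ring
      rw [hw]
      ring
    rw [Finset.sum_congr rfl h]
    simp only [ih, Finset.mul_sum]
    apply Finset.sum_comm'
    intro p l
    simp only [mem_above, Finset.mem_filter]
    constructor
    · rintro ⟨hp, hs, hc⟩
      rw [size_addBox hp] at hs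
      exact ⟨⟨hp, hc⟩, by omega, (contained_addBox hp).trans hc⟩
    · rintro ⟨⟨hp, hc⟩, hs, _⟩
      rw [size_addBox hp]
      exact ⟨hp, by omega, hc⟩

theorem exists_polynomial_one_add_diffLinear_pow [CharZero K] {g : StrictPartition → K} {r : ℕ}
    (hr : diffOp^[r] g = 0) (m : StrictPartition) :
    ∃ P : Polynomial K, ∀ n : ℕ, ((1 + diffLinear K) ^ n) g m = P.eval (n : K) := by
  have hzero : ∀ k, r ≤ k → (diffLinear K ^ k) g = 0 := by
    intro k hk
    rw [← Nat.sub_add_cancel hk, pow_add, Module.End.mul_apply, diffLinear_pow_apply r, hr,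
      map_zero]
  refine ⟨∑ k ∈ Finset.range r, Polynomial.C ((diffLinear K ^ k) g m * (k.factorial : K)⁻¹)
    * descPochhammer K k, fun n => ?_⟩
  have h1 : ((1 + diffLinear K) ^ n) g m
      = ∑ k ∈ Finset.range (n + 1), (n.choose k : K) * (diffLinear K ^ k) g m := by
    rw [add_comm, (Commute.one_right (diffLinear K)).add_pow, LinearMap.sum_apply,
      Finset.sum_apply]
    apply Finset.sum_congr rfl
    intro k _
    rw [one_pow, mul_one, (Nat.cast_commute _ _).symm.eq, ← nsmul_eq_mul, LinearMap.smul_apply,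
      Pi.smul_apply, nsmul_eq_mul]
  have h2 : ∑ k ∈ Finset.range (n + 1), (n.choose k : K) * (diffLinear K ^ k) g m
      = ∑ k ∈ Finset.range (max (n + 1) r), (n.choose k : K) * (diffLinear K ^ k) g m := by
    apply Finset.sum_subset (Finset.range_subset_range.2 (le_max_left _ _))
    intro k _ hk
    rw [Finset.mem_range, not_lt] at hk
    rw [Nat.choose_eq_zero_of_lt hk, Nat.cast_zero, zero_mul]
  have h3 : ∑ k ∈ Finset.range r, (n.choose k : K) * (diffLinear K ^ k) g m
      = ∑ k ∈ Finset.range (max (n + 1) r), (n.choose k : K) * (diffLinear K ^ k) g m := by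
    apply Finset.sum_subset (Finset.range_subset_range.2 (le_max_right _ _))
    intro k _ hk
    rw [Finset.mem_range, not_lt] at hk
    rw [hzero k hk, Pi.zero_apply, mul_zero]
  rw [h1, h2, ← h3, Polynomial.eval_finsetSum]
  apply Finset.sum_congr rfl
  intro k _
  have hk : (k.factorial : K) ≠ 0 := by exact_mod_cast k.factorial_ne_zero
  rw [Polynomial.eval_mul, Polynomial.eval_C, descPochhammer_eval_eq_descFactorial,
    Nat.descFactorial_eq_factorial_mul_choose, Nat.cast_mul]
  field_simp

end

end StrictPartition

theorem mainTheorem1 {K : Type*} [Field K] [CharZero K] {N : ℕ} (ν : Nat.Partition N)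
    (μ : StrictPartition) (Q : SymmetricFunction K) :
    (∃ r : ℕ, ∀ l : StrictPartition,
      (StrictPartition.diffOp^[r] fun k : StrictPartition =>
        Q.eval (k.contentValues K) * k.qPartition K ν / (k.hookProduct : K)) l = 0) ∧
    ∃ P : Polynomial K, ∀ n : ℕ,
      ∑ l ∈ μ.above n,
        (2 : K) ^ ((l.size : ℤ) - μ.size - l.length + μ.length) * (l.numTableaux μ : K)
          / (l.hookProduct : K) * Q.eval (l.contentValues K) * l.qPartition K ν
        = P.eval (n : K) := by
  obtain ⟨d, hd⟩ := StrictPartition.exists_degreeLE_eval_mul_qPartition ν Q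
  have hr := hd.iterate_diffOp_eq_zero
  refine ⟨⟨d + 1, fun l => congrFun hr l⟩, ?_⟩
  obtain ⟨P, hP⟩ := StrictPartition.exists_polynomial_one_add_diffLinear_pow hr μ
  refine ⟨P, fun n => ?_⟩
  rw [← hP, StrictPartition.one_add_diffLinear_pow_apply]
  apply Finset.sum_congr rfl
  intro l _
  ring
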